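/- Let $S^1=[-1,1]/(-1\sim 1)$ with its arc-length distance (total length $2$) and its normalized Lebesgue measure $m$, and let $f:S^1\to S^1$ be the map induced by $x\mapsto 2\sqrt{x}-1$ for $x\ge 0$ and $x\mapsto 1-2\sqrt{|x|}$ for $x<0$. Let $\mathcal S=\{0,\pm1\}$ (two points of $S^1$). A finite nonempty set $\mathcal S\subset S^1$ is a *non-degenerate exceptional set* for $f$ with constants $B>1$, $\beta>0$ if for all $x\notin\mathcal S$ $$\tfrac1B\,\mathrm{dist}(x,\mathcal S)^{\beta}\le |f'(x)|\le B\,\mathrm{dist}(x,\mathcal S)^{-\beta},$$ and for all $x,y\notin\mathcal S$ with $\mathrm{dist}(x,y)<\mathrm{dist}(x,\mathcal S)/2$ both $\bigl|\log|f'(x)^{-1}|-\log|f'(y)^{-1}|\bigr|$ and $\bigl|\log|f'(x)|-\log|f'(y)|\bigr|$ are at most $B\,\mathrm{dist}(x,\mathcal S)^{-\beta}\,\mathrm{dist}(x,y)$. Put $\mathrm{dist}_\delta(x,\mathcal S)=\mathrm{dist}(x,\mathcal S)$ if this is $\le\delta$, and $\mathrm{dist}_\delta(x,\mathcal S)=1$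 otherwise. Given $b>0$, $0<\sigma<1$ and $\delta>0$, an integer $n\ge1$ is a *$(\sigma,\delta)$-hyperbolic time* for $x$ if for all $1\le k\le n$ $$\prod_{j=n-k}^{n-1}|f'(f^j(x))^{-1}|\le\sigma^k\quad\text{and}\quad \mathrm{dist}_\delta(f^{n-k}(x),\mathcal S)\ge\sigma^{bk}.$$ The *first $(\sigma,\delta)$-hyperbolic time map* $h$ assigns to $x$ its least $(\sigma,\delta)$-hyperbolic time ($h(x)=\infty$ if there is none). Then: 1. $f$ is continuous and a local homeomorphism, it is differentiable at $x$ if and only if $x\ne0$, it is a $C^2$ local diffeomorphism at every point outside $\mathcal S$, and $\mathcal S$ is a non-degenerate exceptional set for $f$ with some constants $B>1$, $\beta>0$. 2. $f$ is topologically mixing; moreover, for every nonempty open $J\subset S^1$ there is $N\in\mathbb N$ with $f^N(J)=S^1$. 3. $f$ preserves $m$. 4. Let $B>1$, $\beta>0$ be any constants with which $\mathcal S$ is a non-degenerate exceptional set for $f$, and let $0<b<\min\{1/2,1/(4\beta)\}$. Then (a) there are $0<\sigma<1$, $\delta>0$ and $\theta>0$ such that for $m$-almost every $x$ the following holds: for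 all sufficiently large $n$, at least $\theta n$ of the integers $1,\dots,n$ are $(\sigma,\delta)$-hyperbolic times for $x$; (b) for every $0<\sigma<1$ and $\delta>0$ the first $(\sigma,\delta)$-hyperbolic time map $h$ is not Lebesgue integrable: $\int_{S^1}h\,dm=\infty$. 5. If $x_1\in(0,1)$ and $x_{n+1}=(1+x_n)^2/4$ for $n\ge1$, then $\sum_{n\ge1}n(x_{n+1}-x_n)=+\infty$. -/

import Mathlib

open Set Filter Topology MeasureTheory
open scoped ENNReal

namespace HypTimes

noncomputable section

instance factTwoPos : Fact ((0 : ℝ) < 2) := ⟨two_pos⟩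

/-- The circle `[-1, 1] / (-1 ∼ 1)`, of length `2`, with its arc-length distance. -/
abbrev Circ : Type := AddCircle (2 : ℝ)

/-- Lebesgue measure on the circle, normalized to total mass `1`. -/
def leb : Measure Circ := AddCircle.haarAddCircle

/-- The interval map `x ↦ 2√x - 1` for `x ≥ 0` and `x ↦ 1 - 2√|x|` for `x < 0`. -/
def intervalMap (x : ℝ) : ℝ := if 0 ≤ x then 2 * √x - 1 else 1 - 2 * √|x|

/-- The circle map induced by `intervalMap`: the class of `t ∈ [-1, 1)` is sent to the class of
`intervalMap t`. -/
def circMap : Circ → Circ := AddCircle.liftIco 2 (-1) (fun t => (intervalMap t : Circ))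

/-- The formula holds on all of `[-1, 1]`, i.e. it respects the identification `-1 ∼ 1`. -/
theorem circMap_coe (t : ℝ) (ht : t ∈ Icc (-1 : ℝ) 1) :
    circMap (t : Circ) = (intervalMap t : Circ) := by
  rcases eq_or_lt_of_le ht.2 with h | h
  · subst h
    have e : ((1 : ℝ) : Circ) = ((-1 : ℝ) : Circ) := by
      have := AddCircle.coe_add_period (2 : ℝ) (-1)
      rw [← this]; norm_num
    rw [e, circMap, AddCircle.liftIco_coe_apply (by norm_num)]
    have h1 : intervalMap (-1) = -1 := by norm_num [intervalMap]
    have h2 : intervalMap 1 = 1 := by norm_num [intervalMap]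
    rw [h1, h2, e]
  · exact AddCircle.liftIco_coe_apply (by constructor <;> linarith [ht.1])

/-- The exceptional set `{0, ±1}`: two points of the circle. -/
def excSet : Set Circ := {((0 : ℝ) : Circ), ((1 : ℝ) : Circ)}

/-- The expression of `F : Circ → Circ` in arc-length coordinates `h` centred at `x` and at `F x`;
the coordinate of a point of the circle is its representative in `[-1, 1)`. -/
def localRep (F : Circ → Circ) (x : Circ) (h : ℝ) : ℝ :=
  (AddCircle.equivIco (2 : ℝ) (-1) (F (x + (h : Circ)) - F x) : ℝ)

/-- The derivative `DF(x)`, a real number since the tangent spaces of the circle are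
canonically `ℝ`. Thus `‖DF(x)⁻¹‖ = |circDeriv F x|⁻¹` and `|det DF(x)| = |circDeriv F x|`. -/
def circDeriv (F : Circ → Circ) (x : Circ) : ℝ := deriv (localRep F x) 0

/-- `F` is a `C²` local diffeomorphism at each point outside `S`. -/
def IsC2LocalDiffeoOutside (F : Circ → Circ) (S : Set Circ) : Prop :=
  ∀ x ∉ S, ContDiffAt ℝ 2 (localRep F x) 0 ∧ circDeriv F x ≠ 0

/-- The (nonempty) finite set `S` is a non-degenerate exceptional set for `F`, with constants
`B > 1` and `β > 0`. -/
structure IsNondegenerateExceptional (F : Circ → Circ) (S : Set Circ) (B β : ℝ) : Prop where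
  finite : S.Finite
  one_lt : 1 < B
  pos : 0 < β
  s1 : ∀ x ∉ S, 1 / B * Metric.infDist x S ^ β ≤ |circDeriv F x| ∧
    |circDeriv F x| ≤ B * Metric.infDist x S ^ (-β)
  s2 : ∀ x ∉ S, ∀ y ∉ S, dist x y < Metric.infDist x S / 2 →
    abs (Real.log (|circDeriv F x|⁻¹) - Real.log (|circDeriv F y|⁻¹)) ≤
      B / Metric.infDist x S ^ β * dist x y
  s3 : ∀ x ∉ S, ∀ y ∉ S, dist x y < Metric.infDist x S / 2 →
    abs (Real.log |circDeriv F x| - Real.log |circDeriv F y|) ≤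
      B / Metric.infDist x S ^ β * dist x y

open Classical in
/-- The `δ`-truncated distance from `x` to the (nonempty) set `S`. -/
def truncDist (S : Set Circ) (δ : ℝ) (x : Circ) : ℝ :=
  if Metric.infDist x S ≤ δ then Metric.infDist x S else 1

/-- `n ≥ 1` is a `(σ, δ)`-hyperbolic time for `x`, with respect to the parameter `b`. -/
def IsHyperbolicTime (F : Circ → Circ) (S : Set Circ) (b σ δ : ℝ) (n : ℕ) (x : Circ) : Prop :=
  1 ≤ n ∧ ∀ k : ℕ, 1 ≤ k → k ≤ n →
    (∏ j ∈ Finset.Ico (n - k) n, |circDeriv F (F^[j] x)|⁻¹ ≤ σ ^ k) ∧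
      σ ^ (b * (k : ℝ)) ≤ truncDist S δ (F^[n - k] x)

/-- The frequency of `(σ, δ)`-hyperbolic times for `x` is greater than `θ`: for all large `n`
there are at least `θ n` hyperbolic times for `x` among `1, …, n`. -/
def HasHyperbolicFrequency (F : Circ → Circ) (S : Set Circ) (b σ δ θ : ℝ) (x : Circ) : Prop :=
  ∀ᶠ n : ℕ in atTop, ∃ T : Finset ℕ,
    (∀ j ∈ T, j ≤ n ∧ IsHyperbolicTime F S b σ δ j x) ∧ θ * (n : ℝ) ≤ (T.card : ℝ)

/-- The first `(σ, δ)`-hyperbolic time map, with value `∞` at the points that have no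
`(σ, δ)`-hyperbolic time. -/
def firstHyperbolicTime (F : Circ → Circ) (S : Set Circ) (b σ δ : ℝ) (x : Circ) : ℝ≥0∞ :=
  ⨅ (n : ℕ) (_ : IsHyperbolicTime F S b σ δ n x), (n : ℝ≥0∞)

/-- Topological mixing. -/
def IsTopologicallyMixing {X : Type*} [TopologicalSpace X] (F : X → X) : Prop :=
  ∀ U V : Set X, IsOpen U → U.Nonempty → IsOpen V → V.Nonempty →
    ∃ N : ℕ, ∀ n ≥ N, (F^[n] '' U ∩ V).Nonempty

end

end HypTimes

namespace HypTimes

theorem exists_coe_eq (x : Circ) : ∃ t ∈ Ioc (-1 : ℝ) 1, (t : Circ) = x := by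
  have h : x ∈ ((↑) : ℝ → Circ) '' Ioc (-1 : ℝ) (-1 + 2) := by
    rw [AddCircle.coe_image_Ioc_eq]; trivial
  obtain ⟨t, ht, e⟩ := h
  exact ⟨t, by convert ht using 2; norm_num, e⟩

theorem norm_coe {t : ℝ} (ht : t ∈ Icc (-1 : ℝ) 1) : ‖(t : Circ)‖ = |t| := by
  rw [AddCircle.norm_coe_eq_abs_iff (p := (2 : ℝ)) two_ne_zero]
  rw [abs_le]
  norm_num
  exact ht

theorem norm_le_one (x : Circ) : ‖x‖ ≤ 1 := by
  have := AddCircle.norm_le_half_period (2 : ℝ) (x := x) two_ne_zero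
  norm_num at this
  exact this

theorem coe_eq_coe_of_sub_eq_two {s t : ℝ} (h : s = t + 2) : (s : Circ) = t := by
  rw [h]; exact AddCircle.coe_add_period 2 t

/-- A lift of `circMap - 1` near the origin. -/
noncomputable def liftZero (s : ℝ) : ℝ := 2 * √s - 2 * √(-s)

/-- The lift of `circMap` in coordinates centred at the fixed point. -/
noncomputable def liftOne (h : ℝ) : ℝ := 2 * √(1 + min h 0) - 2 * √(1 - max h 0)

theorem continuous_liftZero : Continuous liftZero := by unfold liftZero; fun_prop

theorem continuous_liftOne : Continuous liftOne := by unfold liftOne; fun_prop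

theorem intervalMap_of_nonneg {t : ℝ} (ht : 0 ≤ t) : intervalMap t = 2 * √t - 1 := by
  simp [intervalMap, ht]

theorem intervalMap_of_neg {t : ℝ} (ht : t < 0) : intervalMap t = 1 - 2 * √(-t) := by
  simp [intervalMap, not_le.2 ht, abs_of_neg ht]

theorem circMap_coe_eq_liftZero {s : ℝ} (hs : s ∈ Icc (-1 : ℝ) 1) :
    circMap (s : Circ) = ((liftZero s + 1 : ℝ) : Circ) := by
  rw [circMap_coe s hs]
  rcases le_or_gt 0 s with h | h
  · rw [intervalMap_of_nonneg h]
    symm; apply coe_eq_coe_of_sub_eq_two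
    rw [liftZero, Real.sqrt_eq_zero_of_nonpos (by linarith : -s ≤ 0)]; ring
  · rw [intervalMap_of_neg h, liftZero, Real.sqrt_eq_zero_of_nonpos h.le]
    congr 1; ring

theorem circMap_coe_eq_liftOne {h : ℝ} (hh : h ∈ Icc (-1 : ℝ) 1) :
    circMap ((1 + h : ℝ) : Circ) = ((1 + liftOne h : ℝ) : Circ) := by
  rcases le_or_gt h 0 with h0 | h0
  · rw [circMap_coe _ ⟨by linarith [hh.1], by linarith⟩, intervalMap_of_nonneg (by linarith [hh.1]),
      liftOne, min_eq_left h0, max_eq_right h0]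
    congr 1; norm_num; ring
  · rw [show ((1 + h : ℝ) : Circ) = ((h - 1 : ℝ) : Circ) from
      coe_eq_coe_of_sub_eq_two (by ring)]
    rcases eq_or_lt_of_le hh.2 with h1 | h1
    · subst h1
      have : circMap ((1 - 1 : ℝ) : Circ) = ((-1 : ℝ) : Circ) := by
        rw [circMap_coe _ (by norm_num), intervalMap_of_nonneg (by norm_num)]; norm_num
      rw [this]
      symm
      rw [show (1 + liftOne 1 : ℝ) = (-1 + 2) + 2 by norm_num [liftOne]]
      rw [coe_eq_coe_of_sub_eq_two rfl, coe_eq_coe_of_sub_eq_two rfl]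
    · rw [circMap_coe _ ⟨by linarith, by linarith⟩, intervalMap_of_neg (by linarith),
        liftOne, min_eq_right h0.le, max_eq_left h0.le]
      symm; apply coe_eq_coe_of_sub_eq_two
      norm_num
      ring

theorem continuous_circMap : Continuous circMap := by
  unfold circMap
  have key : ∀ s ∈ Icc (-1 : ℝ) 1, (intervalMap s : Circ) = ((liftZero s + 1 : ℝ) : Circ) :=
    fun s hs => by rw [← circMap_coe_eq_liftZero hs, circMap_coe s hs]
  apply AddCircle.liftIco_continuous
  · rw [show (-1 + 2 : ℝ) = 1 by norm_num]
    rw [← circMap_coe _ (by norm_num), ← circMap_coe _ (by norm_num)]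
    congr 1
    symm
    apply coe_eq_coe_of_sub_eq_two; norm_num
  · rw [show (-1 + 2 : ℝ) = 1 by norm_num]
    refine ContinuousOn.congr ?_ key
    exact ((AddCircle.continuous_mk' 2).comp
      (continuous_liftZero.add continuous_const)).continuousOn

theorem isLocalHomeomorph_coe : IsLocalHomeomorph ((↑) : ℝ → Circ) := by
  intro x
  refine ⟨AddCircle.openPartialHomeomorphCoe (2 : ℝ) (x - 1), ?_, rfl⟩
  simp only [AddCircle.openPartialHomeomorphCoe_source]
  constructor <;> linarith

theorem liftZero_apply_inverse (u : ℝ) : liftZero (u * |u| / 4) = u := by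
  have h4 : ∀ v : ℝ, 0 ≤ v → √(v * v / 4) = v / 2 := fun v hv => by
    rw [show v * v / 4 = (v / 2) ^ 2 by ring, Real.sqrt_sq (by linarith)]
  rcases le_or_gt 0 u with h | h
  · rw [liftZero, abs_of_nonneg h, h4 u h, Real.sqrt_eq_zero_of_nonpos (by nlinarith)]; ring
  · rw [liftZero, abs_of_neg h, Real.sqrt_eq_zero_of_nonpos (by nlinarith),
      show -(u * -u / 4) = (-u) * (-u) / 4 by ring, h4 (-u) (by linarith)]; ring

theorem liftZero_inverse_apply (s : ℝ) : liftZero s * |liftZero s| / 4 = s := by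
  rcases le_or_gt 0 s with h | h
  · have e : liftZero s = 2 * √s := by
      rw [liftZero, Real.sqrt_eq_zero_of_nonpos (by linarith : -s ≤ 0)]; ring
    rw [e, abs_of_nonneg (by positivity)]
    linear_combination Real.mul_self_sqrt h
  · have e : liftZero s = -(2 * √(-s)) := by
      rw [liftZero, Real.sqrt_eq_zero_of_nonpos h.le]; ring
    rw [e, abs_neg, abs_of_nonneg (by positivity)]
    linear_combination - Real.mul_self_sqrt (by linarith : 0 ≤ -s)

/-- `liftZero` as a homeomorphism of the line. -/
noncomputable def liftZeroHomeo : ℝ ≃ₜ ℝ where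
  toFun := liftZero
  invFun u := u * |u| / 4
  left_inv := liftZero_inverse_apply
  right_inv := liftZero_apply_inverse
  continuous_toFun := continuous_liftZero
  continuous_invFun := by fun_prop

theorem liftOne_of_nonpos {h : ℝ} (h0 : h ≤ 0) : liftOne h = 2 * √(1 + h) - 2 := by
  rw [liftOne, min_eq_left h0, max_eq_right h0]; simp

theorem liftOne_of_nonneg {h : ℝ} (h0 : 0 ≤ h) : liftOne h = 2 - 2 * √(1 - h) := by
  rw [liftOne, min_eq_right h0, max_eq_left h0]; simp

/-- `liftOne` as a homeomorphism from `(-1, 1)` onto `(-2, 2)`. -/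
noncomputable def liftOneHomeo : OpenPartialHomeomorph ℝ ℝ where
  toFun := liftOne
  invFun s := s - s * |s| / 4
  source := Ioo (-1) 1
  target := Ioo (-2) 2
  map_source' := by
    rintro h ⟨h1, h2⟩
    rcases le_total h 0 with h0 | h0
    · rw [liftOne_of_nonpos h0]
      have := Real.sqrt_pos.2 (by linarith : 0 < 1 + h)
      have : √(1 + h) ≤ 1 := Real.sqrt_le_one.2 (by linarith)
      constructor <;> linarith
    · rw [liftOne_of_nonneg h0]
      have := Real.sqrt_pos.2 (by linarith : 0 < 1 - h)
      have : √(1 - h) ≤ 1 := Real.sqrt_le_one.2 (by linarith)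
      constructor <;> linarith
  map_target' := by
    rintro s ⟨h1, h2⟩
    rcases le_total s 0 with h0 | h0
    · rw [abs_of_nonpos h0]; constructor <;> nlinarith
    · rw [abs_of_nonneg h0]; constructor <;> nlinarith
  left_inv' := by
    rintro h ⟨h1, h2⟩
    rcases le_total h 0 with h0 | h0
    · rw [liftOne_of_nonpos h0]
      have : √(1 + h) ≤ 1 := Real.sqrt_le_one.2 (by linarith)
      rw [abs_of_nonpos (by linarith)]
      linear_combination Real.mul_self_sqrt (by linarith : 0 ≤ 1 + h)
    · rw [liftOne_of_nonneg h0]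
      have : √(1 - h) ≤ 1 := Real.sqrt_le_one.2 (by linarith)
      rw [abs_of_nonneg (by linarith)]
      linear_combination - Real.mul_self_sqrt (by linarith : 0 ≤ 1 - h)
  right_inv' := by
    rintro s ⟨h1, h2⟩
    rcases le_total s 0 with h0 | h0
    · rw [abs_of_nonpos h0, liftOne_of_nonpos (by nlinarith),
        show 1 + (s - s * -s / 4) = (1 + s / 2) ^ 2 by ring, Real.sqrt_sq (by linarith)]; ring
    · rw [abs_of_nonneg h0, liftOne_of_nonneg (by nlinarith),
        show 1 - (s - s * s / 4) = (1 - s / 2) ^ 2 by ring, Real.sqrt_sq (by linarith)]; ring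
  open_source := isOpen_Ioo
  open_target := isOpen_Ioo
  continuousOn_toFun := continuous_liftOne.continuousOn
  continuousOn_invFun := by fun_prop

theorem isLocalHomeomorph_circMap : IsLocalHomeomorph circMap := by
  have hadd : ∀ c : ℝ, IsLocalHomeomorph (fun s : ℝ => s + c) := fun c =>
    (Homeomorph.addRight c).isLocalHomeomorph
  have h0 : IsLocalHomeomorphOn (circMap ∘ ((↑) : ℝ → Circ)) (Ioo (-1) 1) := by
    have hl : IsLocalHomeomorph (fun s => ((liftZero s + 1 : ℝ) : Circ)) :=
      isLocalHomeomorph_coe.comp ((hadd 1).comp liftZeroHomeo.isLocalHomeomorph)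
    refine IsLocalHomeomorphOn.mk _ _ fun x hx => ?_
    obtain ⟨e, he, he'⟩ := hl x
    refine ⟨e.restrOpen (Ioo (-1) 1) isOpen_Ioo, ⟨he, hx⟩, fun s hs => ?_⟩
    have := circMap_coe_eq_liftZero (Ioo_subset_Icc_self hs.2)
    simp only [Function.comp, this]
    exact congrFun he' s
  have h1 : IsLocalHomeomorphOn (circMap ∘ fun h : ℝ => ((1 + h : ℝ) : Circ)) (Ioo (-1) 1) := by
    refine IsLocalHomeomorphOn.mk _ _ fun x hx => ?_
    have hl : IsLocalHomeomorph (fun s : ℝ => ((1 + s : ℝ) : Circ)) :=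
      isLocalHomeomorph_coe.comp (Homeomorph.addLeft (1 : ℝ)).isLocalHomeomorph
    obtain ⟨e, he, he'⟩ := hl (liftOne x)
    refine ⟨liftOneHomeo.trans e, ⟨hx, he⟩, fun s hs => ?_⟩
    have := circMap_coe_eq_liftOne (Ioo_subset_Icc_self hs.1)
    simp only [Function.comp, this]
    exact congrFun he' (liftOne s)
  have h0' := h0.of_comp_right isLocalHomeomorph_coe.isLocalHomeomorphOn
  have h1' := h1.of_comp_right (isLocalHomeomorph_coe.comp
      (Homeomorph.addLeft (1 : ℝ)).isLocalHomeomorph).isLocalHomeomorphOn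
  intro x
  obtain ⟨t, ht, rfl⟩ := exists_coe_eq x
  rcases eq_or_lt_of_le ht.2 with h | h
  · exact h1' _ ⟨0, by norm_num, by simp [h]⟩
  · exact h0' _ ⟨t, ⟨ht.1, h⟩, rfl⟩

theorem localRep_eventuallyEq {F : Circ → Circ} {x : Circ} {L : ℝ → ℝ} (hL : ContinuousAt L 0)
    (hF : ∀ᶠ h : ℝ in 𝓝 0, F (x + (h : Circ)) = (L h : Circ)) :
    localRep F x =ᶠ[𝓝 0] fun h => L h - L 0 := by
  have h0 : F x = (L 0 : Circ) := by simpa using hF.self_of_nhds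
  have hlim : Tendsto (fun h => L h - L 0) (𝓝 0) (𝓝 0) := by
    have : ContinuousAt (fun h => L h - L 0) 0 := hL.sub continuousAt_const
    simpa [ContinuousAt] using this
  have hmem : ∀ᶠ h : ℝ in 𝓝 0, L h - L 0 ∈ Ioo (-1 : ℝ) 1 :=
    hlim (Ioo_mem_nhds (by norm_num) (by norm_num))
  filter_upwards [hF, hmem] with h h1 h2
  rw [localRep, h1, h0, ← AddCircle.coe_sub]
  apply AddCircle.equivIco_coe_of_mem
  exact ⟨h2.1.le, by linarith [h2.2]⟩

theorem localRep_circMap_coe {t : ℝ} (ht : t ∈ Ioo (-1 : ℝ) 1) :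
    localRep circMap t =ᶠ[𝓝 0] fun h => liftZero (t + h) - liftZero t := by
  have h1 := localRep_eventuallyEq (F := circMap) (x := (t : Circ))
    (L := fun h => liftZero (t + h) + 1)
    (by have := continuous_liftZero; fun_prop) (by
      have : Tendsto (fun h : ℝ => t + h) (𝓝 0) (𝓝 t) := by
        have : ContinuousAt (fun h : ℝ => t + h) 0 := by fun_prop
        simpa [ContinuousAt] using this
      filter_upwards [this (Ioo_mem_nhds ht.1 ht.2)] with h hh
      rw [← AddCircle.coe_add]
      exact circMap_coe_eq_liftZero (Ioo_subset_Icc_self hh))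
  simpa using h1

theorem localRep_circMap_one :
    localRep circMap ((1 : ℝ) : Circ) =ᶠ[𝓝 0] liftOne := by
  have h1 := localRep_eventuallyEq (F := circMap) (x := ((1 : ℝ) : Circ))
    (L := fun h => 1 + liftOne h)
    (by have := continuous_liftOne; fun_prop) (by
      filter_upwards [Ioo_mem_nhds (by norm_num : (-1 : ℝ) < 0) one_pos] with h hh
      rw [← AddCircle.coe_add]
      exact circMap_coe_eq_liftOne (Ioo_subset_Icc_self hh))
  have h0 : liftOne 0 = 0 := by simp [liftOne]
  simpa [h0] using h1

theorem hasDerivAt_liftZero {t : ℝ} (ht : t ≠ 0) : HasDerivAt liftZero (√|t|)⁻¹ t := by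
  have h1 := ((Real.hasDerivAt_sqrt ht).const_mul 2)
  have h2 := (((Real.hasDerivAt_sqrt (neg_ne_zero.2 ht)).comp t (hasDerivAt_neg t)).const_mul 2)
  have h3 : HasDerivAt liftZero _ t := h1.sub h2
  refine h3.congr_deriv ?_
  rcases lt_or_gt_of_ne ht with h | h
  · rw [abs_of_neg h, Real.sqrt_eq_zero_of_nonpos h.le]; field_simp; ring
  · rw [abs_of_pos h, Real.sqrt_eq_zero_of_nonpos (by linarith : -t ≤ 0)]; field_simp; ring

theorem hasDerivAt_liftOne : HasDerivAt liftOne 1 0 := by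
  have h1 : HasDerivWithinAt liftOne 1 (Iic 0) 0 := by
    have : HasDerivAt (fun h : ℝ => 2 * √(1 + h) - 2) 1 0 := by
      have := (((Real.hasDerivAt_sqrt (x := 1 + 0) (by norm_num)).comp_const_add 1 0).const_mul
        2).sub_const 2
      simpa using this
    exact this.hasDerivWithinAt.congr (fun x hx => liftOne_of_nonpos hx) (liftOne_of_nonpos le_rfl)
  have h2 : HasDerivWithinAt liftOne 1 (Ici 0) 0 := by
    have : HasDerivAt (fun h : ℝ => 2 - 2 * √(1 - h)) 1 0 := by
      have := (((Real.hasDerivAt_sqrt (x := 1 - 0) (by norm_num)).comp_const_sub 1 0).const_mul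
        2).const_sub 2
      simpa using this
    exact this.hasDerivWithinAt.congr (fun x hx => liftOne_of_nonneg hx) (liftOne_of_nonneg le_rfl)
  have := h1.union h2
  rwa [Iic_union_Ici, hasDerivWithinAt_univ] at this

theorem not_differentiableAt_liftZero : ¬ DifferentiableAt ℝ liftZero 0 := by
  intro h
  apply not_differentiableAt_abs_zero
  have h2 : DifferentiableAt ℝ (fun s : ℝ => liftZero (s ^ 2) / 2) 0 := by
    have h3 : DifferentiableAt ℝ (fun s : ℝ => s ^ 2) 0 := by fun_prop
    have h4 : DifferentiableAt ℝ liftZero ((fun s : ℝ => s ^ 2) 0) := by simpa using h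
    exact (DifferentiableAt.comp (f := fun s : ℝ => s ^ 2) (0 : ℝ) h4 h3).div_const 2
  have e : (fun s : ℝ => liftZero (s ^ 2) / 2) = fun s => |s| := by
    funext s
    rw [liftZero, Real.sqrt_sq_eq_abs, Real.sqrt_eq_zero_of_nonpos (by nlinarith)]; ring
  rwa [e] at h2

theorem hasDerivAt_localRep_circMap {x : Circ} (hx : x ≠ 0) :
    HasDerivAt (localRep circMap x) (√‖x‖)⁻¹ 0 := by
  obtain ⟨t, ht, rfl⟩ := exists_coe_eq x
  have ht0 : t ≠ 0 := fun h => hx (by rw [h]; rfl)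
  rw [norm_coe ⟨ht.1.le, ht.2⟩]
  rcases eq_or_lt_of_le ht.2 with h | h
  · subst h
    simpa using hasDerivAt_liftOne.congr_of_eventuallyEq localRep_circMap_one
  · refine HasDerivAt.congr_of_eventuallyEq ?_ (localRep_circMap_coe ⟨ht.1, h⟩)
    have := hasDerivAt_liftZero ht0
    rw [← add_zero t] at this
    simpa using (HasDerivAt.comp_const_add t 0 this).sub_const (liftZero t)

theorem differentiableAt_localRep_circMap_iff (x : Circ) :
    DifferentiableAt ℝ (localRep circMap x) 0 ↔ x ≠ 0 := by
  refine ⟨?_, fun h => (hasDerivAt_localRep_circMap h).differentiableAt⟩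
  rintro h rfl
  have e := localRep_circMap_coe (t := 0) (by norm_num)
  have h0 : liftZero 0 = 0 := by simp [liftZero]
  simp only [zero_add, h0, sub_zero] at e
  exact not_differentiableAt_liftZero (h.congr_of_eventuallyEq e.symm)

theorem circDeriv_circMap (x : Circ) : circDeriv circMap x = (√‖x‖)⁻¹ := by
  rcases eq_or_ne x 0 with rfl | hx
  · rw [circDeriv, deriv_zero_of_not_differentiableAt]
    · simp
    · rw [differentiableAt_localRep_circMap_iff]; simp
  · exact (hasDerivAt_localRep_circMap hx).deriv

theorem inv_abs_circDeriv_circMap (x : Circ) : |circDeriv circMap x|⁻¹ = √‖x‖ := by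
  rw [circDeriv_circMap, abs_of_nonneg (by positivity), inv_inv]

theorem norm_sub_one (x : Circ) : ‖x - ((1 : ℝ) : Circ)‖ = 1 - ‖x‖ := by
  obtain ⟨t, ht, rfl⟩ := exists_coe_eq x
  rw [norm_coe ⟨ht.1.le, ht.2⟩, ← AddCircle.coe_sub]
  rcases le_or_gt 0 t with h | h
  · rw [norm_coe ⟨by linarith, by linarith [ht.2]⟩, abs_of_nonneg h,
      abs_of_nonpos (by linarith [ht.2])]; ring
  · rw [← coe_eq_coe_of_sub_eq_two (show t + 1 = (t - 1) + 2 by ring),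
      norm_coe ⟨by linarith [ht.1], by linarith⟩, abs_of_neg h, abs_of_nonneg (by linarith [ht.1])]
    ring

theorem infDist_excSet (x : Circ) : Metric.infDist x excSet = min ‖x‖ (1 - ‖x‖) := by
  have e0 : dist x ((0 : ℝ) : Circ) = ‖x‖ := by rw [dist_eq_norm]; simp
  have e1 : dist x ((1 : ℝ) : Circ) = 1 - ‖x‖ := by rw [dist_eq_norm, norm_sub_one]
  apply le_antisymm
  · refine le_min ?_ ?_
    · rw [← e0]; exact Metric.infDist_le_dist_of_mem (by simp [excSet])
    · rw [← e1]; exact Metric.infDist_le_dist_of_mem (by simp [excSet])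
  · refine (Metric.le_infDist (s := excSet) ⟨_, Set.mem_insert _ _⟩).2 ?_
    rintro y (rfl | rfl)
    · rw [e0]; exact min_le_left _ _
    · rw [e1]; exact min_le_right _ _

theorem mem_excSet_iff (x : Circ) : x ∈ excSet ↔ ‖x‖ = 0 ∨ ‖x‖ = 1 := by
  have h1 : x = ((1 : ℝ) : Circ) ↔ ‖x‖ = 1 := by
    rw [← sub_eq_zero, ← norm_eq_zero, norm_sub_one, sub_eq_zero, eq_comm]
  rw [excSet, mem_insert_iff, mem_singleton_iff, h1, norm_eq_zero]; rfl

theorem infDist_excSet_pos {x : Circ} (hx : x ∉ excSet) : 0 < Metric.infDist x excSet := by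
  rw [mem_excSet_iff, not_or] at hx
  rw [infDist_excSet]
  exact lt_min ((norm_nonneg x).lt_of_ne' hx.1) (sub_pos.2 ((norm_le_one x).lt_of_ne hx.2))

theorem isC2LocalDiffeoOutside_circMap : IsC2LocalDiffeoOutside circMap excSet := by
  intro x hx
  rw [mem_excSet_iff, not_or] at hx
  obtain ⟨h0, h1⟩ := hx
  refine ⟨?_, by rw [circDeriv_circMap]; have := (norm_nonneg x).lt_of_ne' h0; positivity⟩
  obtain ⟨t, ht, rfl⟩ := exists_coe_eq x
  rw [norm_coe ⟨ht.1.le, ht.2⟩] at h0 h1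
  have ht1 : t < 1 := lt_of_le_of_ne ht.2 fun h => h1 (by rw [h]; simp)
  have ht0 : t ≠ 0 := abs_ne_zero.1 h0
  refine ContDiffAt.congr_of_eventuallyEq ?_ (localRep_circMap_coe ⟨ht.1, ht1⟩)
  unfold liftZero
  have ha : t + 0 ≠ 0 := by simpa using ht0
  have hb : -(t + 0) ≠ 0 := neg_ne_zero.2 ha
  refine ContDiffAt.sub (ContDiffAt.sub ?_ ?_) contDiffAt_const
  · exact contDiffAt_const.mul ((contDiffAt_const.add contDiffAt_id).sqrt ha)
  · exact contDiffAt_const.mul ((contDiffAt_const.add contDiffAt_id).neg.sqrt hb)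

theorem abs_log_sub_log_le {a b d e : ℝ} (hd : 0 < d) (ha : d ≤ a) (hb : d ≤ b)
    (h : |a - b| ≤ e) : |Real.log a - Real.log b| ≤ e / d := by
  wlog hab : a ≤ b generalizing a b
  · rw [abs_sub_comm]; exact this hb ha (by rwa [abs_sub_comm]) (le_of_not_ge hab)
  have ha0 := hd.trans_le ha
  have hb0 := hd.trans_le hb
  rw [abs_sub_comm, abs_of_nonneg (sub_nonneg.2 (Real.log_le_log ha0 hab)),
    ← Real.log_div hb0.ne' ha0.ne']
  rw [abs_sub_comm, abs_of_nonneg (by linarith)] at h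
  have h1 := Real.log_le_sub_one_of_pos (div_pos hb0 ha0)
  have h2 : b / a - 1 = (b - a) / a := by field_simp
  rw [h2] at h1
  refine h1.trans ?_
  gcongr
  linarith

theorem abs_log_circDeriv_sub_le {x y : Circ} (hx : x ∉ excSet)
    (hxy : dist x y < Metric.infDist x excSet / 2) :
    abs (Real.log |circDeriv circMap x| - Real.log |circDeriv circMap y|) ≤
      2 / Metric.infDist x excSet ^ (1 : ℝ) * dist x y := by
  have hd := infDist_excSet_pos hx
  have hle : Metric.infDist x excSet ≤ ‖x‖ := by rw [infDist_excSet]; exact min_le_left _ _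
  set d := Metric.infDist x excSet
  have hxy' : |‖x‖ - ‖y‖| ≤ dist x y := by rw [dist_eq_norm]; exact abs_norm_sub_norm_le x y
  have hy : d / 2 ≤ ‖y‖ := by have := (abs_le.1 hxy').2; linarith
  have e : ∀ z : Circ, Real.log |circDeriv circMap z| = -(Real.log ‖z‖ / 2) := fun z => by
    rw [← Real.log_sqrt (norm_nonneg z), ← Real.log_inv, ← inv_abs_circDeriv_circMap, inv_inv]
  have key := abs_log_sub_log_le (half_pos hd) (by linarith) hy hxy'
  rw [e, e, Real.rpow_one]
  have h2 : -(Real.log ‖x‖ / 2) - -(Real.log ‖y‖ / 2) =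
      -((Real.log ‖x‖ - Real.log ‖y‖) / 2) := by ring
  rw [h2, abs_neg, abs_div, abs_two]
  have h3 : dist x y / (d / 2) = 2 / d * dist x y := by field_simp
  rw [h3] at key
  linarith [abs_nonneg (Real.log ‖x‖ - Real.log ‖y‖)]

theorem isNondegenerateExceptional_circMap :
    IsNondegenerateExceptional circMap excSet 2 1 where
  finite := by simp [excSet]
  one_lt := one_lt_two
  pos := one_pos
  s1 x hx := by
    have hd := infDist_excSet_pos hx
    have hle : Metric.infDist x excSet ≤ ‖x‖ := by rw [infDist_excSet]; exact min_le_left _ _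
    have h1 := norm_le_one x
    have hx0 := hd.trans_le hle
    have hs : 0 < √‖x‖ := Real.sqrt_pos.2 hx0
    have hs1 : √‖x‖ ≤ 1 := Real.sqrt_le_one.2 h1
    rw [circDeriv_circMap, abs_of_nonneg (by positivity), Real.rpow_neg_one, Real.rpow_one]
    constructor
    · have := (one_le_inv₀ hs).2 hs1
      linarith
    · have hss : ‖x‖ ≤ √‖x‖ := by
        nlinarith [Real.mul_self_sqrt hx0.le]
      have := inv_anti₀ hd (hle.trans hss)
      have : 0 < (Metric.infDist x excSet)⁻¹ := by positivity
      linarith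
  s2 x hx y _ hxy := by
    rw [Real.log_inv, Real.log_inv, neg_sub_neg, abs_sub_comm]
    exact abs_log_circDeriv_sub_le hx hxy
  s3 x hx y _ hxy := abs_log_circDeriv_sub_le hx hxy

/-- The probability weights of the two inverse branches. -/
noncomputable def branchWeight (i : Bool) (y : ℝ) : ℝ := if i then (1 + y) / 2 else (1 - y) / 2

/-- The two inverse branches of the interval map, on `[-1, 1]`. -/
noncomputable def invBranch (i : Bool) (y : ℝ) : ℝ :=
  if i then branchWeight true y ^ 2 else -branchWeight false y ^ 2

/-- Compositions of inverse branches; the head of the word is applied first. -/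
noncomputable def invBranchWord : List Bool → ℝ → ℝ
  | [], y => y
  | i :: v, y => invBranchWord v (invBranch i y)

theorem branchWeight_true (y : ℝ) : branchWeight true y = (1 + y) / 2 := rfl

theorem branchWeight_false (y : ℝ) : branchWeight false y = (1 - y) / 2 := rfl

theorem invBranch_true (y : ℝ) : invBranch true y = ((1 + y) / 2) ^ 2 := rfl

theorem invBranch_false (y : ℝ) : invBranch false y = -((1 - y) / 2) ^ 2 := rfl

theorem invBranch_mem (i : Bool) {y : ℝ} (hy : y ∈ Icc (-1 : ℝ) 1) :
    invBranch i y ∈ Icc (-1 : ℝ) 1 := by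
  obtain ⟨h1, h2⟩ := hy
  cases i <;> simp only [invBranch_true, invBranch_false] <;> constructor <;> nlinarith

theorem invBranchWord_mem (w : List Bool) {y : ℝ} (hy : y ∈ Icc (-1 : ℝ) 1) :
    invBranchWord w y ∈ Icc (-1 : ℝ) 1 := by
  induction w generalizing y with
  | nil => exact hy
  | cons i v ih => exact ih (invBranch_mem i hy)

theorem circMap_invBranch (i : Bool) {y : ℝ} (hy : y ∈ Icc (-1 : ℝ) 1) :
    circMap (invBranch i y : Circ) = (y : Circ) := by
  rw [circMap_coe _ (invBranch_mem i hy)]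
  obtain ⟨h1, h2⟩ := hy
  cases i
  · rcases eq_or_lt_of_le h2 with h | h
    · subst h
      rw [show intervalMap (invBranch false 1) = -1 by
        norm_num [invBranch, branchWeight, intervalMap]]
      symm; apply coe_eq_coe_of_sub_eq_two; norm_num
    · have hneg : invBranch false y < 0 := by
        rw [invBranch_false]; nlinarith
      rw [intervalMap_of_neg hneg, invBranch_false, neg_neg, Real.sqrt_sq (by linarith)]
      congr 1; ring
  · rw [invBranch_true, intervalMap_of_nonneg (by positivity), Real.sqrt_sq (by linarith)]
    congr 1; ring

theorem iterate_circMap_invBranchWord (w : List Bool) {y : ℝ} (hy : y ∈ Icc (-1 : ℝ) 1) :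
    circMap^[w.length] (invBranchWord w y : Circ) = (y : Circ) := by
  induction w generalizing y with
  | nil => rfl
  | cons i v ih =>
    rw [List.length_cons, Function.iterate_succ_apply', invBranchWord, ih (invBranch_mem i hy),
      circMap_invBranch i hy]

theorem abs_invBranch_sub_le (i : Bool) {a b : ℝ} (ha : a ∈ Icc (-1 : ℝ) 1)
    (hb : b ∈ Icc (-1 : ℝ) 1) :
    |invBranch i a - invBranch i b| ≤ |a - b| - |a - b| ^ 2 / 4 := by
  wlog hab : a ≤ b generalizing a b
  · rw [abs_sub_comm, abs_sub_comm a]; exact this hb ha (le_of_not_ge hab)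
  obtain ⟨h1, h2⟩ := ha
  obtain ⟨h3, h4⟩ := hb
  rw [abs_sub_comm a, abs_of_nonneg (sub_nonneg.2 hab)]
  cases i <;> simp only [invBranch_true, invBranch_false] <;> rw [abs_le] <;>
    constructor <;> nlinarith

theorem abs_invBranchWord_sub_le (w : List Bool) (k : ℕ) {a b : ℝ} (ha : a ∈ Icc (-1 : ℝ) 1)
    (hb : b ∈ Icc (-1 : ℝ) 1) (hab : |a - b| ≤ 4 / (k + 2)) :
    |invBranchWord w a - invBranchWord w b| ≤ 4 / (k + w.length + 2) := by
  induction w generalizing a b k with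
  | nil => simpa [invBranchWord] using hab
  | cons i v ih =>
    have hstep : |invBranch i a - invBranch i b| ≤ 4 / ((k + 1 : ℕ) + 2) := by
      refine (abs_invBranch_sub_le i ha hb).trans ?_
      have hk : (0 : ℝ) ≤ k := k.cast_nonneg
      have h2 : (4 : ℝ) / (k + 2) ≤ 2 := by rw [div_le_iff₀ (by positivity)]; linarith
      have hmono : |a - b| - |a - b| ^ 2 / 4 ≤ 4 / (k + 2) - (4 / (k + 2)) ^ 2 / 4 := by
        nlinarith [abs_nonneg (a - b)]
      refine hmono.trans ?_
      push_cast
      rw [div_pow, div_div, div_sub_div _ _ (by positivity) (by positivity),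
        div_le_div_iff₀ (by positivity) (by positivity)]
      have : 0 ≤ (k + 2 : ℝ) := by positivity
      nlinarith [this]
    refine (ih (k + 1) (invBranch_mem i ha) (invBranch_mem i hb) hstep).trans (le_of_eq ?_)
    push_cast [List.length_cons]
    ring

theorem abs_invBranchWord_sub_le' (w : List Bool) {a b : ℝ} (ha : a ∈ Icc (-1 : ℝ) 1)
    (hb : b ∈ Icc (-1 : ℝ) 1) :
    |invBranchWord w a - invBranchWord w b| ≤ 4 / (w.length + 2) := by
  have := abs_invBranchWord_sub_le w 0 ha hb (by
    obtain ⟨h1, h2⟩ := ha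
    obtain ⟨h3, h4⟩ := hb
    rw [abs_le]; norm_num; constructor <;> linarith)
  simpa using this

theorem exists_invBranch_eq {z : ℝ} (hz : z ∈ Icc (-1 : ℝ) 1) :
    ∃ i, ∃ y ∈ Icc (-1 : ℝ) 1, invBranch i y = z := by
  rcases le_total 0 z with h | h
  · have h1 : √z ≤ 1 := Real.sqrt_le_one.2 hz.2
    have h0 := Real.sqrt_nonneg z
    refine ⟨true, 2 * √z - 1, ⟨by linarith, by linarith⟩, ?_⟩
    rw [invBranch_true]
    linear_combination Real.mul_self_sqrt h
  · have h1 : √(-z) ≤ 1 := Real.sqrt_le_one.2 (by linarith [hz.1])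
    have h0 := Real.sqrt_nonneg (-z)
    refine ⟨false, 1 - 2 * √(-z), ⟨by linarith, by linarith⟩, ?_⟩
    rw [invBranch_false]
    linear_combination - Real.mul_self_sqrt (by linarith : 0 ≤ -z)

theorem exists_invBranchWord_eq (n : ℕ) {x : ℝ} (hx : x ∈ Icc (-1 : ℝ) 1) :
    ∃ w : List Bool, w.length = n ∧ ∃ y ∈ Icc (-1 : ℝ) 1, invBranchWord w y = x := by
  induction n with
  | zero => exact ⟨[], rfl, x, hx, rfl⟩
  | succ n ih =>
    obtain ⟨v, hv, z, hz, e⟩ := ih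
    obtain ⟨i, y, hy, rfl⟩ := exists_invBranch_eq hz
    exact ⟨i :: v, by simp [hv], y, hy, e⟩

theorem dist_coe_le (a b : ℝ) : dist (a : Circ) (b : Circ) ≤ |a - b| := by
  rw [dist_eq_norm, ← AddCircle.coe_sub]
  exact QuotientAddGroup.norm_mk_le_norm

theorem exists_four_div_lt {ε : ℝ} (hε : 0 < ε) : ∃ n : ℕ, 4 / ((n : ℝ) + 2) < ε := by
  obtain ⟨n, hn⟩ := exists_nat_gt (4 / ε)
  refine ⟨n, ?_⟩
  rw [div_lt_iff₀ hε] at hn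
  rw [div_lt_iff₀ (by positivity)]
  nlinarith

theorem circMap_eventually_onto (J : Set Circ) (hJ : IsOpen J) (hne : J.Nonempty) :
    ∃ N : ℕ, circMap^[N] '' J = univ := by
  obtain ⟨x, hx⟩ := hne
  obtain ⟨ε, hε, hball⟩ := Metric.isOpen_iff.1 hJ x hx
  obtain ⟨t, ht, rfl⟩ := exists_coe_eq x
  obtain ⟨n, hn⟩ := exists_four_div_lt hε
  obtain ⟨w, rfl, y, hy, rfl⟩ := exists_invBranchWord_eq n (Ioc_subset_Icc_self ht)
  refine ⟨w.length, eq_univ_of_forall fun z => ?_⟩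
  obtain ⟨s, hs, rfl⟩ := exists_coe_eq z
  refine ⟨_, hball ?_, iterate_circMap_invBranchWord w (Ioc_subset_Icc_self hs)⟩
  exact (dist_coe_le _ _).trans_lt
    ((abs_invBranchWord_sub_le' w (Ioc_subset_Icc_self hs) hy).trans_lt hn)

theorem circMap_surjective : Function.Surjective circMap := by
  intro x
  obtain ⟨t, ht, rfl⟩ := exists_coe_eq x
  exact ⟨_, circMap_invBranch true (Ioc_subset_Icc_self ht)⟩

theorem isTopologicallyMixing_circMap : IsTopologicallyMixing circMap := by
  intro U V hU hU' _ hV'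
  obtain ⟨N, hN⟩ := circMap_eventually_onto U hU hU'
  refine ⟨N, fun n hn => ?_⟩
  obtain ⟨k, rfl⟩ := Nat.exists_eq_add_of_le hn
  rw [add_comm, Function.iterate_add, image_comp, hN,
    image_univ_of_surjective (circMap_surjective.iterate k), univ_inter]
  exact hV'

theorem hasDerivAt_invBranch (i : Bool) (y : ℝ) :
    HasDerivAt (invBranch i) (branchWeight i y) y := by
  cases i
  · have h : HasDerivAt (fun y : ℝ => -((1 - y) / 2) ^ 2) _ y :=
      ((((hasDerivAt_id y).const_sub 1).div_const 2).pow 2).neg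
    refine h.congr_deriv ?_
    rw [branchWeight_false]; simp; ring
  · have h : HasDerivAt (fun y : ℝ => ((1 + y) / 2) ^ 2) _ y :=
      (((hasDerivAt_id y).const_add 1).div_const 2).pow 2
    refine h.congr_deriv ?_
    rw [branchWeight_true]; simp; ring

theorem continuous_invBranch (i : Bool) : Continuous (invBranch i) :=
  continuous_iff_continuousAt.2 fun y => (hasDerivAt_invBranch i y).continuousAt

theorem continuous_branchWeight (i : Bool) : Continuous (branchWeight i) := by
  cases i
  · exact (continuous_const.sub continuous_id).div_const 2
  · exact (continuous_const.add continuous_id).div_const 2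

theorem branchWeight_nonneg (i : Bool) {y : ℝ} (hy : y ∈ Icc (-1 : ℝ) 1) :
    0 ≤ branchWeight i y := by
  obtain ⟨h1, h2⟩ := hy
  cases i
  · rw [branchWeight_false]; linarith
  · rw [branchWeight_true]; linarith

theorem injOn_invBranch (i : Bool) : InjOn (invBranch i) (Ioo (-1) 1) := by
  rintro a ⟨h1, h2⟩ b ⟨h3, h4⟩ h
  cases i
  · rw [invBranch_false, invBranch_false, neg_inj, pow_left_inj₀ (by linarith) (by linarith)
      two_ne_zero] at h
    linarith
  · rw [invBranch_true, invBranch_true, pow_left_inj₀ (by linarith) (by linarith)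
      two_ne_zero] at h
    linarith

theorem image_invBranch_true : invBranch true '' Ioo (-1) 1 = Ioo 0 1 := by
  ext z
  constructor
  · rintro ⟨y, ⟨h1, h2⟩, rfl⟩
    rw [invBranch_true]; constructor <;> nlinarith
  · rintro ⟨h1, h2⟩
    have hs0 := Real.sqrt_pos.2 h1
    have hs1 : √z < 1 := by rw [Real.sqrt_lt' one_pos]; linarith
    refine ⟨2 * √z - 1, ⟨by linarith, by linarith⟩, ?_⟩
    rw [invBranch_true]
    linear_combination Real.mul_self_sqrt h1.le

theorem image_invBranch_false : invBranch false '' Ioo (-1) 1 = Ioo (-1) 0 := by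
  ext z
  constructor
  · rintro ⟨y, ⟨h1, h2⟩, rfl⟩
    rw [invBranch_false]; constructor <;> nlinarith
  · rintro ⟨h1, h2⟩
    have hs0 := Real.sqrt_pos.2 (by linarith : 0 < -z)
    have hs1 : √(-z) < 1 := by rw [Real.sqrt_lt' one_pos]; linarith
    refine ⟨1 - 2 * √(-z), ⟨by linarith, by linarith⟩, ?_⟩
    rw [invBranch_false]
    linear_combination -Real.mul_self_sqrt (by linarith : 0 ≤ -z)

theorem lintegral_branchWeight_mul (i : Bool) (g : ℝ → ℝ≥0∞) :
    ∫⁻ y in Ioo (-1) 1, ENNReal.ofReal (branchWeight i y) * g (invBranch i y) =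
      ∫⁻ y in invBranch i '' Ioo (-1) 1, g y := by
  rw [lintegral_image_eq_lintegral_abs_deriv_mul measurableSet_Ioo
    (fun y _ => (hasDerivAt_invBranch i y).hasDerivWithinAt) (injOn_invBranch i)]
  refine setLIntegral_congr_fun measurableSet_Ioo fun y hy => ?_
  rw [abs_of_nonneg (branchWeight_nonneg i (Ioo_subset_Icc_self hy))]

theorem lintegral_transfer {g : ℝ → ℝ≥0∞} (hg : Measurable g) :
    ∫⁻ y in Ioo (-1) 1, (ENNReal.ofReal (branchWeight true y) * g (invBranch true y) +
      ENNReal.ofReal (branchWeight false y) * g (invBranch false y)) =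
      ∫⁻ y in Ioo (-1) 1, g y := by
  have hsplit : ∫⁻ y in Ioo (-1) 1, g y =
      (∫⁻ y in Ioo (-1) 0, g y) + ∫⁻ y in Ioo 0 1, g y := by
    rw [← Ioc_union_Ioo_eq_Ioo (a := (-1 : ℝ)) (b := 0) (c := 1) (by norm_num) (by norm_num),
      lintegral_union measurableSet_Ioo,
      setLIntegral_congr (Ioo_ae_eq_Ioc (a := (-1 : ℝ)) (b := 0))]
    rw [Set.disjoint_left]
    rintro z ⟨_, h1⟩ ⟨h2, _⟩
    linarith
  have hm : Measurable fun y => ENNReal.ofReal (branchWeight true y) * g (invBranch true y) :=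
    (continuous_branchWeight true).measurable.ennreal_ofReal.mul
      (hg.comp (continuous_invBranch true).measurable)
  rw [lintegral_add_left hm, lintegral_branchWeight_mul, lintegral_branchWeight_mul,
    image_invBranch_true, image_invBranch_false, hsplit, add_comm]

theorem measurable_coe : Measurable ((↑) : ℝ → Circ) := (AddCircle.continuous_mk' 2).measurable

instance isProbabilityMeasure_leb : IsProbabilityMeasure leb :=
  inferInstanceAs (IsProbabilityMeasure (AddCircle.haarAddCircle (T := 2)))

theorem lintegral_leb {g : Circ → ℝ≥0∞} (hg : Measurable g) :
    ∫⁻ x, g x ∂leb = 2⁻¹ * ∫⁻ t in Ioo (-1 : ℝ) 1, g (t : Circ) := by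
  have h1 := (AddCircle.measurePreserving_mk 2 (-1)).lintegral_comp hg
  rw [AddCircle.volume_eq_smul_haarAddCircle, lintegral_smul_measure,
    show (-1 + 2 : ℝ) = 1 by norm_num, ← setLIntegral_congr Ioo_ae_eq_Ioc] at h1
  rw [h1, leb, smul_eq_mul, ← mul_assoc]
  simp [ENNReal.inv_mul_cancel]

theorem measurePreserving_circMap : MeasurePreserving circMap leb leb := by
  refine ⟨continuous_circMap.measurable, ?_⟩
  ext A hA
  rw [Measure.map_apply continuous_circMap.measurable hA,
    ← lintegral_indicator_one hA,
    ← lintegral_indicator_one (continuous_circMap.measurable hA)]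
  have hm : Measurable (A.indicator (1 : Circ → ℝ≥0∞)) := measurable_one.indicator hA
  have hm' : Measurable ((circMap ⁻¹' A).indicator (1 : Circ → ℝ≥0∞)) :=
    measurable_one.indicator (continuous_circMap.measurable hA)
  rw [lintegral_leb hm, lintegral_leb hm']
  congr 1
  refine (lintegral_transfer (hm'.comp measurable_coe)).symm.trans ?_
  refine setLIntegral_congr_fun measurableSet_Ioo fun y hy => ?_
  have hy' := Ioo_subset_Icc_self hy
  have e : ∀ i, (circMap ⁻¹' A).indicator (1 : Circ → ℝ≥0∞) (invBranch i y : Circ) =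
      A.indicator 1 (y : Circ) := fun i => by
    rw [← congrArg (A.indicator (1 : Circ → ℝ≥0∞)) (circMap_invBranch i hy')]
    rfl
  simp only [Function.comp, e]
  rw [← add_mul, ← ENNReal.ofReal_add (branchWeight_nonneg _ hy') (branchWeight_nonneg _ hy'),
    branchWeight_true, branchWeight_false]
  ring_nf
  simp

theorem orbit_mem_Ioo {x : ℕ → ℝ} (h1 : x 1 ∈ Ioo (0 : ℝ) 1)
    (hx : ∀ n : ℕ, 1 ≤ n → x (n + 1) = (1 + x n) ^ 2 / 4) {n : ℕ} (hn : 1 ≤ n) :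
    x n ∈ Ioo (0 : ℝ) 1 := by
  induction n, hn using Nat.le_induction with
  | base => exact h1
  | succ n hn ih =>
    obtain ⟨h2, h3⟩ := ih
    rw [hx n hn]
    constructor <;> nlinarith

theorem exists_div_le_one_sub_orbit {x : ℕ → ℝ} (h1 : x 1 ∈ Ioo (0 : ℝ) 1)
    (hx : ∀ n : ℕ, 1 ≤ n → x (n + 1) = (1 + x n) ^ 2 / 4) :
    ∃ c : ℝ, 0 < c ∧ c ≤ 1 ∧ ∀ n : ℕ, 1 ≤ n → c / n ≤ 1 - x n := by
  refine ⟨1 - x 1, by linarith [h1.2], by linarith [h1.1], fun n hn => ?_⟩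
  have hc0 : 0 < 1 - x 1 := by linarith [h1.2]
  have hc1 : 1 - x 1 ≤ 1 := by linarith [h1.1]
  induction n, hn using Nat.le_induction with
  | base => simp
  | succ n hn ih =>
    obtain ⟨h2, h3⟩ := orbit_mem_Ioo h1 hx hn
    have hn0 : (1 : ℝ) ≤ n := by exact_mod_cast hn
    have e : 1 - x (n + 1) = (1 - x n) - (1 - x n) ^ 2 / 4 := by rw [hx n hn]; ring
    rw [e]
    set c := 1 - x 1
    have hcn : c / n ≤ 1 := by rw [div_le_one (by positivity)]; linarith
    have hmono : c / n - (c / n) ^ 2 / 4 ≤ (1 - x n) - (1 - x n) ^ 2 / 4 := by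
      nlinarith [show 0 < c / n by positivity]
    refine le_trans ?_ hmono
    push_cast
    have key : c / n - (c / n) ^ 2 / 4 - c / (n + 1) =
        c * (4 * n - c * (n + 1)) / (4 * n ^ 2 * (n + 1)) := by
      field_simp; ring
    have : 0 ≤ c * (4 * n - c * (n + 1)) / (4 * n ^ 2 * (n + 1)) := by
      have : 0 ≤ 4 * n - c * (n + 1) := by nlinarith
      positivity
    linarith

theorem tendsto_sum_Icc_div_atTop {c : ℝ} (hc : 0 < c) :
    Tendsto (fun N : ℕ => ∑ n ∈ Finset.Icc 1 N, c / (n : ℝ)) atTop atTop := by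
  have h := Real.tendsto_sum_range_one_div_nat_succ_atTop.const_mul_atTop hc
  refine h.congr fun N => ?_
  induction N with
  | zero => simp
  | succ N ih =>
    rw [Finset.sum_range_succ, mul_add, ih, Finset.sum_Icc_succ_top (by omega)]
    push_cast
    ring

theorem tendsto_sum_mul_orbit_sub_atTop {x : ℕ → ℝ} (h1 : x 1 ∈ Ioo (0 : ℝ) 1)
    (hx : ∀ n : ℕ, 1 ≤ n → x (n + 1) = (1 + x n) ^ 2 / 4) :
    Tendsto (fun N : ℕ => ∑ n ∈ Finset.Icc 1 N, (n : ℝ) * (x (n + 1) - x n)) atTop atTop := by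
  obtain ⟨c, hc, -, hle⟩ := exists_div_le_one_sub_orbit h1 hx
  refine tendsto_atTop_mono (fun N => Finset.sum_le_sum fun n hn => ?_)
    (tendsto_sum_Icc_div_atTop (show 0 < c ^ 2 / 4 by positivity))
  have hn1 := (Finset.mem_Icc.1 hn).1
  have hn0 : (1 : ℝ) ≤ n := by exact_mod_cast hn1
  have e : x (n + 1) - x n = (1 - x n) ^ 2 / 4 := by rw [hx n hn1]; ring
  have h2 : (c / n) ^ 2 ≤ (1 - x n) ^ 2 := pow_le_pow_left₀ (by positivity) (hle n hn1) 2
  calc c ^ 2 / 4 / n = n * ((c / n) ^ 2 / 4) := by field_simp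
    _ ≤ n * (x (n + 1) - x n) := by rw [e]; gcongr

theorem orbit_one_le {x : ℕ → ℝ} (hx : ∀ n : ℕ, 1 ≤ n → x (n + 1) = (1 + x n) ^ 2 / 4) {n : ℕ}
    (hn : 1 ≤ n) : x 1 ≤ x n := by
  induction n, hn using Nat.le_induction with
  | base => exact le_rfl
  | succ n hn ih => rw [hx n hn]; nlinarith [sq_nonneg (1 - x n)]

theorem exists_iterate_circMap_eq {x : ℕ → ℝ} (h1 : x 1 ∈ Ioo (0 : ℝ) 1)
    (hx : ∀ n : ℕ, 1 ≤ n → x (n + 1) = (1 + x n) ^ 2 / 4) {n : ℕ} {t : ℝ}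
    (ht : t ∈ Ioo (x n) 1) {j : ℕ} (hj : j < n) :
    ∃ s ∈ Ioo (x (n - j)) 1, circMap^[j] (t : Circ) = (s : Circ) := by
  induction j with
  | zero => exact ⟨t, ht, rfl⟩
  | succ j ih =>
    obtain ⟨s, ⟨hs1, hs2⟩, e⟩ := ih (by omega)
    obtain ⟨k, hk⟩ : ∃ k, n - j = k + 1 := ⟨n - j - 1, by omega⟩
    have hk1 : 1 ≤ k := by omega
    have hk' : n - (j + 1) = k := by omega
    have h0 := (orbit_mem_Ioo h1 hx hk1).1
    rw [hk, hx k hk1] at hs1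
    have hs0 : 0 < s := lt_trans (by positivity) hs1
    refine ⟨2 * √s - 1, ⟨?_, ?_⟩, ?_⟩
    · rw [hk']
      have : (1 + x k) / 2 < √s := Real.lt_sqrt_of_sq_lt (by linarith)
      linarith
    · have : √s < 1 := by rw [Real.sqrt_lt' one_pos]; linarith
      linarith
    · rw [Function.iterate_succ_apply', e, circMap_coe s ⟨by linarith, hs2.le⟩,
        intervalMap_of_nonneg hs0.le]

theorem not_isHyperbolicTime {x : ℕ → ℝ} {b σ δ : ℝ} (hσ0 : 0 < σ) (hσ1 : σ < 1)
    (h1 : x 1 = σ ^ 2) (hx : ∀ n : ℕ, 1 ≤ n → x (n + 1) = (1 + x n) ^ 2 / 4) {n m : ℕ}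
    {t : ℝ} (ht : t ∈ Ioo (x n) 1) (hmn : m ≤ n) :
    ¬ IsHyperbolicTime circMap excSet b σ δ m (t : Circ) := by
  rintro ⟨hm, h⟩
  have h1' : x 1 ∈ Ioo (0 : ℝ) 1 := by rw [h1]; constructor <;> nlinarith
  have hprod := (h 1 le_rfl hm).1
  obtain ⟨s, ⟨hs1, hs2⟩, e⟩ := exists_iterate_circMap_eq h1' hx ht (show m - 1 < n by omega)
  have hI : Finset.Ico (m - 1) m = {m - 1} := by
    ext j; simp only [Finset.mem_Ico, Finset.mem_singleton]; omega
  rw [hI, Finset.prod_singleton, e, inv_abs_circDeriv_circMap, pow_one] at hprod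
  have hle := orbit_one_le hx (show 1 ≤ n - (m - 1) by omega)
  rw [h1] at hle
  have hs0 : 0 ≤ s := by nlinarith
  rw [norm_coe ⟨by linarith, hs2.le⟩, abs_of_nonneg hs0, Real.sqrt_le_left hσ0.le] at hprod
  linarith

theorem measurableSet_image_coe_Ioo (a b : ℝ) :
    MeasurableSet (((↑) : ℝ → Circ) '' Ioo a b) :=
  (isLocalHomeomorph_coe.isOpenMap _ isOpen_Ioo).measurableSet

theorem le_leb_image_coe_Ioo {a : ℝ} (ha : -1 ≤ a) :
    ENNReal.ofReal ((1 - a) / 2) ≤ leb (((↑) : ℝ → Circ) '' Ioo a 1) := by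
  have hA := measurableSet_image_coe_Ioo a 1
  rw [← lintegral_indicator_one hA, lintegral_leb (measurable_one.indicator hA),
    div_eq_inv_mul, ENNReal.ofReal_mul (by norm_num), ENNReal.ofReal_inv_of_pos two_pos,
    ENNReal.ofReal_ofNat]
  gcongr
  rw [← Real.volume_Ioo, ← setLIntegral_one]
  refine (setLIntegral_mono' measurableSet_Ioo fun t ht => ?_).trans
    (lintegral_mono_set (Ioo_subset_Ioo_left ha))
  rw [indicator_of_mem (mem_image_of_mem _ ht)]; rfl

theorem lintegral_firstHyperbolicTime_circMap {b σ δ : ℝ} (hσ0 : 0 < σ) (hσ1 : σ < 1) :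
    ∫⁻ x, firstHyperbolicTime circMap excSet b σ δ x ∂leb = ∞ := by
  set x : ℕ → ℝ := fun n => (fun y : ℝ => (1 + y) ^ 2 / 4)^[n - 1] (σ ^ 2) with hxdef
  have h1 : x 1 = σ ^ 2 := rfl
  have hx : ∀ n : ℕ, 1 ≤ n → x (n + 1) = (1 + x n) ^ 2 / 4 := fun n hn => by
    obtain ⟨k, rfl⟩ := Nat.exists_eq_add_of_le' hn
    simp only [hxdef, Nat.add_sub_cancel, Function.iterate_succ_apply']
  have h1' : x 1 ∈ Ioo (0 : ℝ) 1 := by rw [h1]; constructor <;> nlinarith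
  obtain ⟨c, hc, -, hle⟩ := exists_div_le_one_sub_orbit h1' hx
  set A : ℕ → Set Circ := fun n => ((↑) : ℝ → Circ) '' Ioo (x n) 1
  have hpt : ∀ (N : ℕ) (z : Circ),
      ∑ n ∈ Finset.Icc 1 N, (A n).indicator (1 : Circ → ℝ≥0∞) z ≤
        firstHyperbolicTime circMap excSet b σ δ z := fun N z => by
    refine le_iInf₂ fun m hm => ?_
    have h2 : ∀ n ∈ Finset.Icc 1 N, (A n).indicator (1 : Circ → ℝ≥0∞) z ≤
        if n < m then 1 else 0 := fun n _ => by
      split_ifs with hn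
      · exact indicator_le_self' (fun _ _ => zero_le_one) z
      · rw [indicator_of_notMem]
        rintro ⟨t, ht, rfl⟩
        exact not_isHyperbolicTime hσ0 hσ1 h1 hx ht (not_lt.1 hn) hm
    refine (Finset.sum_le_sum h2).trans ?_
    rw [Finset.sum_boole]
    have : ((Finset.Icc 1 N).filter (· < m)).card ≤ m := by
      refine (Finset.card_le_card (t := Finset.range m) fun n hn => ?_).trans (by simp)
      exact Finset.mem_range.2 (Finset.mem_filter.1 hn).2
    exact_mod_cast this
  have hlow : ∀ N : ℕ, ENNReal.ofReal (∑ n ∈ Finset.Icc 1 N, c / 2 / (n : ℝ)) ≤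
      ∫⁻ x, firstHyperbolicTime circMap excSet b σ δ x ∂leb := fun N => by
    refine le_trans ?_ (lintegral_mono (hpt N))
    rw [lintegral_finsetSum _ fun n _ => measurable_one.indicator (measurableSet_image_coe_Ioo _ _),
      ENNReal.ofReal_sum_of_nonneg fun n _ => by positivity]
    refine Finset.sum_le_sum fun n hn => ?_
    have hn1 := (Finset.mem_Icc.1 hn).1
    rw [lintegral_indicator_one (measurableSet_image_coe_Ioo _ _)]
    refine le_trans (ENNReal.ofReal_le_ofReal ?_)
      (le_leb_image_coe_Ioo (by linarith [(orbit_mem_Ioo h1' hx hn1).1]))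
    have := hle n hn1
    rw [div_right_comm]
    linarith
  have hlim := ENNReal.tendsto_ofReal_atTop.comp (tendsto_sum_Icc_div_atTop (half_pos hc))
  exact top_unique (le_of_tendsto' hlim hlow)

/-- The transfer operator of the interval map. -/
noncomputable def transfer (g : ℝ → ℝ) (y : ℝ) : ℝ :=
  branchWeight true y * g (invBranch true y) + branchWeight false y * g (invBranch false y)

/-- Differentiable `[0, 1]`-valued functions on `[-1, 1]`, Lipschitz for the hyperbolic metric of
`(-1, 1)` with a fixed constant. -/
structure IsHypLipschitz (φ : ℝ → ℝ) : Prop where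
  differentiable : Differentiable ℝ φ
  mem : ∀ y ∈ Icc (-1 : ℝ) 1, φ y ∈ Icc (0 : ℝ) 1
  abs_deriv_le : ∀ y ∈ Ioo (-1 : ℝ) 1, |deriv φ y| ≤ 2 / (1 - y ^ 2)

theorem isHypLipschitz_const {c : ℝ} (hc : c ∈ Icc (0 : ℝ) 1) : IsHypLipschitz fun _ => c where
  differentiable := differentiable_const c
  mem _ _ := hc
  abs_deriv_le y hy := by
    have : 0 < 1 - y ^ 2 := by nlinarith [hy.1, hy.2]
    rw [deriv_const, abs_zero]; positivity

theorem sq_mul_two_div_le {p : ℝ} (h0 : 0 < p) (h1 : p < 1) :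
    p ^ 2 * (2 / (1 - (p ^ 2) ^ 2)) ≤ 1 / (2 * (1 - p)) - 1 / 4 := by
  have hq : 0 < 1 - p := by linarith
  have hd : 1 - (p ^ 2) ^ 2 = (1 - p) * ((1 + p) * (1 + p ^ 2)) := by ring
  have e : 1 / (2 * (1 - p)) - 1 / 4 - p ^ 2 * (2 / (1 - (p ^ 2) ^ 2)) =
      ((1 + p) ^ 2 * (1 + p ^ 2) - 8 * p ^ 2) / (4 * ((1 - p) * ((1 + p) * (1 + p ^ 2)))) := by
    rw [hd]; field_simp; ring
  have hnum : 0 ≤ (1 + p) ^ 2 * (1 + p ^ 2) - 8 * p ^ 2 := by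
    have : (1 + p) ^ 2 * (1 + p ^ 2) - 8 * p ^ 2 =
        (1 - p) * ((1 - p) * (1 + p ^ 2) + 4 * p * (1 - p)) := by ring
    rw [this]; positivity
  have : 0 ≤ 1 / (2 * (1 - p)) - 1 / 4 - p ^ 2 * (2 / (1 - (p ^ 2) ^ 2)) := by
    rw [e]; positivity
  linarith

theorem IsHypLipschitz.combine {φ ψ : ℝ → ℝ} (hφ : IsHypLipschitz φ) (hψ : IsHypLipschitz ψ) :
    IsHypLipschitz fun y => branchWeight true y * φ (invBranch true y) +
      branchWeight false y * ψ (invBranch false y) := by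
  have hD : ∀ y, HasDerivAt (fun y => branchWeight true y * φ (invBranch true y) +
      branchWeight false y * ψ (invBranch false y))
      ((φ (invBranch true y) - ψ (invBranch false y)) / 2 +
        branchWeight true y ^ 2 * deriv φ (invBranch true y) +
        branchWeight false y ^ 2 * deriv ψ (invBranch false y)) y := fun y => by
    have hp : HasDerivAt (branchWeight true) (1 / 2) y :=
      ((hasDerivAt_id y).const_add 1).div_const 2
    have hq : HasDerivAt (branchWeight false) (-1 / 2) y :=
      ((hasDerivAt_id y).const_sub 1).div_const 2
    have h1 := (hφ.differentiable (invBranch true y)).hasDerivAt.comp y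
      (hasDerivAt_invBranch true y)
    have h2 := (hψ.differentiable (invBranch false y)).hasDerivAt.comp y
      (hasDerivAt_invBranch false y)
    refine ((hp.mul h1).add (hq.mul h2)).congr_deriv ?_
    simp only [Function.comp]
    ring
  refine ⟨fun y => (hD y).differentiableAt, fun y hy => ?_, fun y hy => ?_⟩
  · obtain ⟨a1, a2⟩ := hφ.mem _ (invBranch_mem true hy)
    obtain ⟨b1, b2⟩ := hψ.mem _ (invBranch_mem false hy)
    have hp := branchWeight_nonneg true hy
    have hq := branchWeight_nonneg false hy
    have hpq : branchWeight true y + branchWeight false y = 1 := by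
      rw [branchWeight_true, branchWeight_false]; ring
    constructor
    · positivity
    · nlinarith
  · rw [(hD y).deriv]
    have hy' := Ioo_subset_Icc_self hy
    obtain ⟨a1, a2⟩ := hφ.mem _ (invBranch_mem true hy')
    obtain ⟨b1, b2⟩ := hψ.mem _ (invBranch_mem false hy')
    obtain ⟨y1, y2⟩ := hy
    have hp0 : 0 < (1 + y) / 2 := by linarith
    have hq0 : 0 < (1 - y) / 2 := by linarith
    have hd1 := hφ.abs_deriv_le (invBranch true y)
      (by rw [invBranch_true]; constructor <;> nlinarith)
    have hd2 := hψ.abs_deriv_le (invBranch false y)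
      (by rw [invBranch_false]; constructor <;> nlinarith)
    have k1 := sq_mul_two_div_le hp0 (by linarith)
    have k2 := sq_mul_two_div_le hq0 (by linarith)
    rw [invBranch_true] at hd1 a1 a2
    rw [invBranch_false, neg_sq] at hd2
    rw [invBranch_false] at b1 b2
    rw [invBranch_true, invBranch_false, branchWeight_true, branchWeight_false]
    have t1 : |(φ (((1 + y) / 2) ^ 2) - ψ (-((1 - y) / 2) ^ 2)) / 2| ≤ 1 / 2 := by
      rw [abs_le]; constructor <;> linarith
    have t2 : |((1 + y) / 2) ^ 2 * deriv φ (((1 + y) / 2) ^ 2)| ≤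
        1 / (2 * (1 - (1 + y) / 2)) - 1 / 4 := by
      rw [abs_mul, abs_of_nonneg (sq_nonneg ((1 + y) / 2))]
      exact (mul_le_mul_of_nonneg_left hd1 (sq_nonneg _)).trans k1
    have t3 : |((1 - y) / 2) ^ 2 * deriv ψ (-((1 - y) / 2) ^ 2)| ≤
        1 / (2 * (1 - (1 - y) / 2)) - 1 / 4 := by
      rw [abs_mul, abs_of_nonneg (sq_nonneg ((1 - y) / 2))]
      exact (mul_le_mul_of_nonneg_left hd2 (sq_nonneg _)).trans k2
    have e : 2 / (1 - y ^ 2) = 1 / 2 + (1 / (2 * (1 - (1 + y) / 2)) - 1 / 4) +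
        (1 / (2 * (1 - (1 - y) / 2)) - 1 / 4) := by
      have n1 : 1 - y ≠ 0 := by linarith
      have n2 : 1 + y ≠ 0 := by linarith
      rw [show 1 - y ^ 2 = (1 - y) * (1 + y) by ring,
        show 2 * (1 - (1 + y) / 2) = 1 - y by ring, show 2 * (1 - (1 - y) / 2) = 1 + y by ring]
      field_simp; ring
    rw [e]
    exact (abs_add_three _ _ _).trans (add_le_add (add_le_add t1 t2) t3)

theorem exists_isHypLipschitz_abs_iterate_transfer_sub_le (n : ℕ) (c : List Bool → ℝ)
    (hc : ∀ w, c w ∈ Icc (0 : ℝ) 1) :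
    ∃ φ, IsHypLipschitz φ ∧ ∀ (g : ℝ → ℝ) (y η : ℝ), y ∈ Icc (-1 : ℝ) 1 →
      (∀ w : List Bool, w.length = n → |g (invBranchWord w y) - c w| ≤ η) →
        |transfer^[n] g y - φ y| ≤ η := by
  induction n generalizing c with
  | zero => exact ⟨_, isHypLipschitz_const (hc []), fun g y η _ h => h [] rfl⟩
  | succ n ih =>
    obtain ⟨φ, hφ, hφ'⟩ := ih (fun w => c (true :: w)) fun w => hc _
    obtain ⟨ψ, hψ, hψ'⟩ := ih (fun w => c (false :: w)) fun w => hc _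
    refine ⟨_, hφ.combine hψ, fun g y η hy h => ?_⟩
    have h1 := hφ' g (invBranch true y) η (invBranch_mem true hy)
      fun w hw => h (true :: w) (by simp [hw])
    have h2 := hψ' g (invBranch false y) η (invBranch_mem false hy)
      fun w hw => h (false :: w) (by simp [hw])
    rw [Function.iterate_succ_apply', transfer]
    have hp := branchWeight_nonneg true hy
    have hq := branchWeight_nonneg false hy
    have hpq : branchWeight true y + branchWeight false y = 1 := by
      rw [branchWeight_true, branchWeight_false]; ring
    rw [abs_le] at h1 h2 ⊢
    constructor <;> nlinarith

theorem measurable_transfer {g : ℝ → ℝ} (hg : Measurable g) : Measurable (transfer g) :=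
  ((continuous_branchWeight true).measurable.mul
    (hg.comp (continuous_invBranch true).measurable)).add
    ((continuous_branchWeight false).measurable.mul
      (hg.comp (continuous_invBranch false).measurable))

theorem measurable_iterate_transfer {g : ℝ → ℝ} (hg : Measurable g) (n : ℕ) :
    Measurable (transfer^[n] g) := by
  induction n with
  | zero => exact hg
  | succ n ih => rw [Function.iterate_succ_apply']; exact measurable_transfer ih

theorem lintegral_enorm_transfer_sub_le {g χ : ℝ → ℝ} (hg : Measurable g) (hχ : Measurable χ)
    (hinv : ∀ i, ∀ y ∈ Ioo (-1 : ℝ) 1, χ (invBranch i y) = χ y) :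
    ∫⁻ y in Ioo (-1) 1, ‖transfer g y - χ y‖ₑ ≤ ∫⁻ y in Ioo (-1) 1, ‖g y - χ y‖ₑ := by
  rw [← lintegral_transfer (g := fun y => ‖g y - χ y‖ₑ) (hg.sub hχ).enorm]
  refine setLIntegral_mono' measurableSet_Ioo fun y hy => ?_
  have hy' := Ioo_subset_Icc_self hy
  have hp := branchWeight_nonneg true hy'
  have hq := branchWeight_nonneg false hy'
  have e : transfer g y - χ y =
      branchWeight true y * (g (invBranch true y) - χ (invBranch true y)) +
      branchWeight false y * (g (invBranch false y) - χ (invBranch false y)) := by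
    rw [hinv true y hy, hinv false y hy, transfer, branchWeight_true, branchWeight_false]; ring
  rw [e]
  refine (enorm_add_le _ _).trans (le_of_eq ?_)
  rw [enorm_mul, enorm_mul, Real.enorm_of_nonneg hp, Real.enorm_of_nonneg hq]

theorem lintegral_enorm_iterate_transfer_sub_le {g χ : ℝ → ℝ} (hg : Measurable g)
    (hχ : Measurable χ) (hinv : ∀ i, ∀ y ∈ Ioo (-1 : ℝ) 1, χ (invBranch i y) = χ y) (n : ℕ) :
    ∫⁻ y in Ioo (-1) 1, ‖transfer^[n] g y - χ y‖ₑ ≤ ∫⁻ y in Ioo (-1) 1, ‖g y - χ y‖ₑ := by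
  induction n with
  | zero => exact le_rfl
  | succ n ih =>
    rw [Function.iterate_succ_apply']
    exact (lintegral_enorm_transfer_sub_le (measurable_iterate_transfer hg n) hχ hinv).trans ih

theorem exists_isHypLipschitz_lintegral_enorm_sub_le {A : Set ℝ} (hA : MeasurableSet A)
    (hinv : ∀ i, ∀ y ∈ Ioo (-1 : ℝ) 1, invBranch i y ∈ A ↔ y ∈ A) {ε : ℝ} (hε : 0 < ε) :
    ∃ φ, IsHypLipschitz φ ∧
      ∫⁻ y in Ioo (-1) 1, ‖φ y - A.indicator (fun _ => (1 : ℝ)) y‖ₑ ≤ ENNReal.ofReal (3 * ε) := by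
  set χ := A.indicator (fun _ => (1 : ℝ)) with hχdef
  have hχm : Measurable χ := measurable_const.indicator hA
  have hint : Integrable ((Ioo (-1 : ℝ) 1).indicator χ) := by
    rw [integrable_indicator_iff measurableSet_Ioo]
    refine Integrable.mono' (g := fun _ => (1 : ℝ)) (by simp) hχm.aestronglyMeasurable
      (ae_of_all _ fun y => ?_)
    simp only [hχdef, indicator]
    split_ifs <;> simp
  obtain ⟨g₀, -, hg₀, hg₀c, hg₀i⟩ := hint.exists_hasCompactSupport_integral_sub_le hε
  set g : ℝ → ℝ := fun y => max 0 (min 1 (g₀ y)) with hgdef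
  have hgc : Continuous g := continuous_const.max (continuous_const.min hg₀c)
  have hgmem : ∀ y, g y ∈ Icc (0 : ℝ) 1 := fun y =>
    ⟨le_max_left _ _, max_le zero_le_one (min_le_left _ _)⟩
  have hgχ : ∫⁻ y in Ioo (-1) 1, ‖g y - χ y‖ₑ ≤ ENNReal.ofReal ε := by
    calc ∫⁻ y in Ioo (-1) 1, ‖g y - χ y‖ₑ
        ≤ ∫⁻ y in Ioo (-1) 1, ‖(Ioo (-1 : ℝ) 1).indicator χ y - g₀ y‖ₑ := by
          refine setLIntegral_mono' measurableSet_Ioo fun y hy => ?_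
          rw [indicator_of_mem hy, ← ofReal_norm, ← ofReal_norm]
          refine ENNReal.ofReal_le_ofReal ?_
          rw [Real.norm_eq_abs, Real.norm_eq_abs, abs_sub_comm (χ y)]
          simp only [hχdef, indicator, hgdef]
          split_ifs
          · rcases le_total 1 (g₀ y) with h | h
            · rw [min_eq_left h]; simp
            · rw [min_eq_right h, abs_of_nonpos, abs_of_nonpos]
              · have := le_max_right 0 (g₀ y); linarith
              · linarith
              · have : max 0 (g₀ y) ≤ 1 := max_le zero_le_one h
                linarith
          · rw [sub_zero, sub_zero, abs_of_nonneg (le_max_left _ _)]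
            exact max_le (abs_nonneg _) ((min_le_right _ _).trans (le_abs_self _))
      _ ≤ ∫⁻ y, ‖(Ioo (-1 : ℝ) 1).indicator χ y - g₀ y‖ₑ := setLIntegral_le_lintegral _ _
      _ = ENNReal.ofReal (∫ y, ‖(Ioo (-1 : ℝ) 1).indicator χ y - g₀ y‖) :=
          (ofReal_integral_norm_eq_lintegral_enorm (hint.sub hg₀i)).symm
      _ ≤ ENNReal.ofReal ε := ENNReal.ofReal_le_ofReal hg₀
  have huc := isCompact_Icc (a := (-1 : ℝ)) (b := 1) |>.uniformContinuousOn_of_continuous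
    hgc.continuousOn
  obtain ⟨δ, hδ, hδ'⟩ := Metric.uniformContinuousOn_iff.1 huc ε hε
  obtain ⟨n, hn⟩ := exists_four_div_lt hδ
  have h0 : (0 : ℝ) ∈ Icc (-1 : ℝ) 1 := by norm_num
  obtain ⟨φ, hφ, hφ'⟩ := exists_isHypLipschitz_abs_iterate_transfer_sub_le n
    (fun w => g (invBranchWord w 0)) fun w => hgmem _
  refine ⟨φ, hφ, ?_⟩
  have hclose : ∀ y ∈ Ioo (-1 : ℝ) 1, ‖φ y - transfer^[n] g y‖ₑ ≤ ENNReal.ofReal ε := by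
    intro y hy
    have hy' := Ioo_subset_Icc_self hy
    rw [← ofReal_norm, Real.norm_eq_abs, abs_sub_comm]
    refine ENNReal.ofReal_le_ofReal (hφ' g y ε hy' fun w hw => ?_)
    refine (hδ' _ (invBranchWord_mem w hy') _ (invBranchWord_mem w h0) ?_).le
    have := abs_invBranchWord_sub_le' w hy' h0
    rw [hw] at this
    exact this.trans_lt hn
  have hχinv : ∀ i, ∀ y ∈ Ioo (-1 : ℝ) 1, χ (invBranch i y) = χ y := fun i y hy => by
    by_cases h : y ∈ A
    · rw [hχdef, indicator_of_mem h, indicator_of_mem ((hinv i y hy).2 h)]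
    · rw [hχdef, indicator_of_notMem h, indicator_of_notMem fun h' => h ((hinv i y hy).1 h')]
  calc ∫⁻ y in Ioo (-1) 1, ‖φ y - χ y‖ₑ
      ≤ ∫⁻ y in Ioo (-1) 1, (ENNReal.ofReal ε + ‖transfer^[n] g y - χ y‖ₑ) := by
        refine setLIntegral_mono' measurableSet_Ioo fun y hy => ?_
        rw [show φ y - χ y = (φ y - transfer^[n] g y) + (transfer^[n] g y - χ y) by ring]
        exact (enorm_add_le _ _).trans (by gcongr; exact hclose y hy)
    _ = ENNReal.ofReal (2 * ε) + ∫⁻ y in Ioo (-1) 1, ‖transfer^[n] g y - χ y‖ₑ := by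
        rw [lintegral_add_left measurable_const, setLIntegral_const, Real.volume_Ioo,
          ← ENNReal.ofReal_mul hε.le]
        congr 2; ring
    _ ≤ ENNReal.ofReal (2 * ε) + ENNReal.ofReal ε := by
        gcongr
        exact (lintegral_enorm_iterate_transfer_sub_le hgc.measurable hχm hχinv n).trans hgχ
    _ = ENNReal.ofReal (3 * ε) := by
        rw [← ENNReal.ofReal_add (by positivity) hε.le]; congr 1; ring

theorem leb_apply {E : Set Circ} (hE : MeasurableSet E) :
    leb E = 2⁻¹ * volume (((↑) : ℝ → Circ) ⁻¹' E ∩ Ioo (-1) 1) := by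
  rw [← lintegral_indicator_one hE, lintegral_leb (measurable_one.indicator hE),
    ← Measure.restrict_apply (measurable_coe hE), ← lintegral_indicator_one (measurable_coe hE)]
  rfl

theorem mul_volume_le_setLIntegral {f : ℝ → ℝ≥0∞} {s t : Set ℝ} {c : ℝ≥0∞} (hst : s ⊆ t)
    (hs : MeasurableSet s) (h : ∀ y ∈ s, c ≤ f y) : c * volume s ≤ ∫⁻ y in t, f y := by
  rw [← setLIntegral_const]
  exact (setLIntegral_mono' hs h).trans (lintegral_mono_set hst)

theorem IsHypLipschitz.abs_sub_le {φ : ℝ → ℝ} (hφ : IsHypLipschitz φ) {r z y : ℝ} (hr0 : 0 ≤ r)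
    (hr1 : r < 1) (hz : z ∈ Icc (-r) r) (hy : |y - z| ≤ (1 - r) / 16) :
    y ∈ Ioo (-1 : ℝ) 1 ∧ |φ y - φ z| ≤ 1 / 4 := by
  rw [abs_le] at hy
  have hsub : ∀ u ∈ Icc (-((1 + r) / 2)) ((1 + r) / 2),
      ‖deriv φ u‖ ≤ 4 / (1 - r) := fun u hu => by
    refine (hφ.abs_deriv_le u ⟨by linarith [hu.1], by linarith [hu.2]⟩).trans ?_
    have : u ^ 2 ≤ ((1 + r) / 2) ^ 2 := sq_le_sq.2 (by
      rw [abs_of_nonneg (by linarith : 0 ≤ (1 + r) / 2)]; exact abs_le.2 hu)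
    rw [div_le_div_iff₀ (by nlinarith) (by linarith)]
    nlinarith
  have hyI : y ∈ Icc (-((1 + r) / 2)) ((1 + r) / 2) :=
    ⟨by linarith [hz.1], by linarith [hz.2]⟩
  have hzI : z ∈ Icc (-((1 + r) / 2)) ((1 + r) / 2) :=
    ⟨by linarith [hz.1], by linarith [hz.2]⟩
  refine ⟨⟨by linarith [hyI.1], by linarith [hyI.2]⟩, ?_⟩
  have := (convex_Icc (-((1 + r) / 2)) ((1 + r) / 2)).norm_image_sub_le_of_norm_deriv_le
    (fun u _ => hφ.differentiable u) hsub hzI hyI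
  rw [Real.norm_eq_abs, Real.norm_eq_abs] at this
  refine this.trans ?_
  have h1 : 0 < 1 - r := by linarith
  calc 4 / (1 - r) * |y - z| ≤ 4 / (1 - r) * ((1 - r) / 16) := by
        gcongr; exact abs_le.2 hy
    _ = 1 / 4 := by field_simp; norm_num

theorem IsHypLipschitz.min_le_lintegral {φ : ℝ → ℝ} (hφ : IsHypLipschitz φ) {A : Set ℝ}
    (hA : MeasurableSet A) {r : ℝ} (hr0 : 0 ≤ r) (hr1 : r < 1) :
    min (ENNReal.ofReal (1 / 2) * volume (A ∩ Icc (-r) r))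
      (min (ENNReal.ofReal (1 / 2) * volume (Aᶜ ∩ Icc (-r) r)) (ENNReal.ofReal ((1 - r) / 32))) ≤
      ∫⁻ y in Ioo (-1) 1, ‖φ y - A.indicator (fun _ => (1 : ℝ)) y‖ₑ := by
  have hrI : Icc (-r) r ⊆ Ioo (-1 : ℝ) 1 := fun y hy =>
    ⟨by linarith [hy.1], by linarith [hy.2]⟩
  have hen : ∀ {c x : ℝ}, c ≤ |x| → ENNReal.ofReal c ≤ ‖x‖ₑ := fun h => by
    rw [← ofReal_norm]; exact ENNReal.ofReal_le_ofReal h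
  by_cases h0 : ∀ t ∈ A ∩ Icc (-r) r, φ t ≤ 1 / 2
  · refine (min_le_left _ _).trans (mul_volume_le_setLIntegral (inter_subset_right.trans hrI)
      (hA.inter measurableSet_Icc) fun y hy => hen ?_)
    rw [indicator_of_mem hy.1, abs_sub_comm]
    exact le_trans (by linarith [h0 y hy]) (le_abs_self _)
  by_cases h1 : ∀ t ∈ Aᶜ ∩ Icc (-r) r, 1 / 2 ≤ φ t
  · refine (min_le_right _ _).trans ((min_le_left _ _).trans (mul_volume_le_setLIntegral
      (inter_subset_right.trans hrI) (hA.compl.inter measurableSet_Icc) fun y hy => hen ?_))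
    rw [indicator_of_notMem hy.1, sub_zero]
    exact le_trans (h1 y hy) (le_abs_self _)
  refine (min_le_right _ _).trans ((min_le_right _ _).trans ?_)
  push Not at h0 h1
  obtain ⟨t₀, ⟨-, ht₀⟩, h0⟩ := h0
  obtain ⟨t₁, ⟨-, ht₁⟩, h1⟩ := h1
  obtain ⟨z, hz, hz'⟩ := (intermediate_value_uIcc (a := t₁) (b := t₀)
    hφ.differentiable.continuous.continuousOn) (mem_uIcc.2 (Or.inl ⟨h1.le, h0.le⟩))
  have hzI : z ∈ Icc (-r) r := (ordConnected_Icc.uIcc_subset ht₁ ht₀) hz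
  have hball : ∀ y ∈ Icc (z - (1 - r) / 16) (z + (1 - r) / 16), |y - z| ≤ (1 - r) / 16 :=
    fun y hy => abs_le.2 ⟨by linarith [hy.1], by linarith [hy.2]⟩
  have := mul_volume_le_setLIntegral (c := ENNReal.ofReal (1 / 4))
    (f := fun y => ‖φ y - A.indicator (fun _ => (1 : ℝ)) y‖ₑ)
    (fun y hy => (hφ.abs_sub_le hr0 hr1 hzI (hball y hy)).1) measurableSet_Icc fun y hy => hen ?_
  · refine le_trans (le_of_eq ?_) this
    rw [Real.volume_Icc, ← ENNReal.ofReal_mul (by norm_num)]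
    congr 1; ring
  · have h2 := abs_le.1 (hφ.abs_sub_le hr0 hr1 hzI (hball y hy)).2
    rw [hz'] at h2
    simp only [indicator]
    split_ifs
    · rw [abs_sub_comm]; exact le_trans (by linarith) (le_abs_self _)
    · rw [sub_zero]; exact le_trans (by linarith) (le_abs_self _)

theorem exists_volume_inter_Icc_pos {A : Set ℝ} (hA : volume (A ∩ Ioo (-1) 1) ≠ 0) :
    ∃ r : ℝ, 0 ≤ r ∧ r < 1 ∧ ∀ s, r ≤ s → 0 < volume (A ∩ Icc (-s) s) := by
  have hU : A ∩ Ioo (-1) 1 ⊆ ⋃ n : ℕ, A ∩ Icc (-(1 - 1 / ((n : ℝ) + 1))) (1 - 1 / (n + 1)) := by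
    rintro y ⟨hyA, h1, h2⟩
    have hy : |y| < 1 := abs_lt.2 ⟨h1, h2⟩
    obtain ⟨n, hn⟩ := exists_nat_one_div_lt (sub_pos.2 hy)
    exact mem_iUnion.2 ⟨n, hyA, abs_le.1 (by linarith)⟩
  obtain ⟨n, hn⟩ := exists_measure_pos_of_not_measure_iUnion_null
    (fun h => hA (measure_mono_null hU h))
  have hpos : (0 : ℝ) < 1 / ((n : ℝ) + 1) := by positivity
  have hle : 1 / ((n : ℝ) + 1) ≤ 1 := by
    rw [div_le_one (by positivity)]; linarith [n.cast_nonneg (α := ℝ)]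
  exact ⟨1 - 1 / ((n : ℝ) + 1), by linarith, by linarith, fun s hs => hn.trans_le
    (measure_mono (inter_subset_inter_right _ (Icc_subset_Icc (by linarith) hs)))⟩

theorem ergodic_circMap : Ergodic circMap leb := by
  refine ⟨measurePreserving_circMap, ⟨fun E hE hinv => ?_⟩⟩
  set A : Set ℝ := ((↑) : ℝ → Circ) ⁻¹' E with hAdef
  have hA : MeasurableSet A := measurable_coe hE
  have hAinv : ∀ i, ∀ y ∈ Ioo (-1 : ℝ) 1, invBranch i y ∈ A ↔ y ∈ A := fun i y hy => by
    have h1 : (invBranch i y : Circ) ∈ E ↔ (invBranch i y : Circ) ∈ circMap ⁻¹' E := by rw [hinv]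
    rw [mem_preimage, circMap_invBranch i (Ioo_subset_Icc_self hy)] at h1
    exact h1
  rw [eventuallyConst_set]
  by_contra hcon
  rw [not_or] at hcon
  obtain ⟨hc1, hc2⟩ := hcon
  have h1 : volume (Aᶜ ∩ Ioo (-1) 1) ≠ 0 := fun h => hc1 (by
    change leb Eᶜ = 0
    rw [leb_apply hE.compl, preimage_compl, h, mul_zero])
  have h2 : volume (A ∩ Ioo (-1) 1) ≠ 0 := fun h => hc2 (by
    rw [← measure_eq_zero_iff_ae_notMem, leb_apply hE, h, mul_zero])
  obtain ⟨r₁, hr₁, hr₁', hv₁⟩ := exists_volume_inter_Icc_pos h1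
  obtain ⟨r₂, hr₂, hr₂', hv₂⟩ := exists_volume_inter_Icc_pos h2
  have hr1 : max r₁ r₂ < 1 := max_lt hr₁' hr₂'
  have hv₁ := hv₁ _ (le_max_left r₁ r₂)
  have hv₂ := hv₂ _ (le_max_right r₁ r₂)
  set m := min (ENNReal.ofReal (1 / 2) * volume (A ∩ Icc (-max r₁ r₂) (max r₁ r₂)))
    (min (ENNReal.ofReal (1 / 2) * volume (Aᶜ ∩ Icc (-max r₁ r₂) (max r₁ r₂)))
      (ENNReal.ofReal ((1 - max r₁ r₂) / 32))) with hm
  have hhalf : 0 < ENNReal.ofReal (1 / 2) := by simp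
  have hmpos : 0 < m := lt_min (ENNReal.mul_pos hhalf.ne' hv₂.ne')
    (lt_min (ENNReal.mul_pos hhalf.ne' hv₁.ne') (ENNReal.ofReal_pos.2 (by linarith)))
  have hmtop : m ≠ ∞ := ne_top_of_le_ne_top ENNReal.ofReal_ne_top
    ((min_le_right _ _).trans (min_le_right _ _))
  have hmr := ENNReal.toReal_pos hmpos.ne' hmtop
  obtain ⟨φ, hφ, hφ'⟩ := exists_isHypLipschitz_lintegral_enorm_sub_le hA hAinv
    (ε := m.toReal / 6) (by positivity)
  have := (hφ.min_le_lintegral hA (hr₁.trans (le_max_left r₁ r₂)) hr1).trans hφ'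
  rw [← hm, ← ENNReal.ofReal_toReal hmtop, ENNReal.ofReal_le_ofReal_iff (by positivity),
    ENNReal.toReal_ofReal hmr.le] at this
  linarith

/-- The maximum of the first Birkhoff sums of `g` (including the empty one). -/
noncomputable def maxBirkhoffSum {α : Type*} (f : α → α) (g : α → ℝ) : ℕ → α → ℝ
  | 0, _ => 0
  | n + 1, x => max 0 (g x + maxBirkhoffSum f g n (f x))

section Birkhoff

variable {α : Type*} {f : α → α} {g : α → ℝ}

theorem maxBirkhoffSum_nonneg (n : ℕ) (x : α) : 0 ≤ maxBirkhoffSum f g n x := by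
  cases n with
  | zero => exact le_rfl
  | succ n => exact le_max_left _ _

theorem monotone_maxBirkhoffSum (x : α) : Monotone fun n => maxBirkhoffSum f g n x := by
  refine monotone_nat_of_le_succ fun n => ?_
  induction n generalizing x with
  | zero => exact maxBirkhoffSum_nonneg 1 x
  | succ n ih => exact max_le_max le_rfl (add_le_add le_rfl (ih (f x)))

theorem birkhoffSum_le_maxBirkhoffSum (n : ℕ) (x : α) :
    birkhoffSum f g n x ≤ maxBirkhoffSum f g n x := by
  induction n generalizing x with
  | zero => exact le_rfl
  | succ n ih =>
    rw [birkhoffSum_succ']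
    exact (add_le_add le_rfl (ih (f x))).trans (le_max_right _ _)

theorem tendsto_maxBirkhoffSum_atTop {x : α}
    (hx : ¬ BddAbove (range fun n => birkhoffSum f g n x)) :
    Tendsto (fun n => maxBirkhoffSum f g n x) atTop atTop := by
  refine tendsto_atTop_atTop_of_monotone (monotone_maxBirkhoffSum x) fun C => ?_
  rw [not_bddAbove_iff] at hx
  obtain ⟨_, ⟨n, rfl⟩, hn⟩ := hx C
  exact ⟨n, hn.le.trans (birkhoffSum_le_maxBirkhoffSum n x)⟩

theorem bddAbove_birkhoffSum_apply_iff (x : α) :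
    BddAbove (range fun n => birkhoffSum f g n (f x)) ↔
      BddAbove (range fun n => birkhoffSum f g n x) := by
  constructor
  · rintro ⟨C, hC⟩
    refine ⟨max 0 (g x + C), ?_⟩
    rintro _ ⟨n, rfl⟩
    cases n with
    | zero => exact le_max_left _ _
    | succ n =>
      simp only [birkhoffSum_succ']
      exact le_max_of_le_right (add_le_add le_rfl (hC ⟨n, rfl⟩))
  · rintro ⟨C, hC⟩
    refine ⟨C - g x, ?_⟩
    rintro _ ⟨n, rfl⟩
    have := hC ⟨n + 1, rfl⟩
    simp only [birkhoffSum_succ'] at this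
    simp only
    linarith

variable [MeasurableSpace α] {μ : Measure α}

theorem measurable_maxBirkhoffSum (hf : Measurable f) (hg : Measurable g) (n : ℕ) :
    Measurable (maxBirkhoffSum f g n) := by
  induction n with
  | zero => exact measurable_const
  | succ n ih => exact measurable_const.max (hg.add (ih.comp hf))

theorem integrable_maxBirkhoffSum (hf : MeasurePreserving f μ μ) (hg : Integrable g μ)
    (n : ℕ) : Integrable (maxBirkhoffSum f g n) μ := by
  induction n with
  | zero => exact integrable_zero _ _ _
  | succ n ih =>
    exact (integrable_zero α ℝ μ).sup (hg.add (hf.integrable_comp_of_integrable ih))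

/-- For an ergodic map, the Birkhoff sums of an integrable function with negative mean are almost
everywhere bounded above. -/
theorem _root_.Ergodic.ae_bddAbove_birkhoffSum (hf : Ergodic f μ) (hgm : Measurable g)
    (hg : Integrable g μ) (hneg : ∫ x, g x ∂μ < 0) :
    ∀ᵐ x ∂μ, BddAbove (range fun n => birkhoffSum f g n x) := by
  have hfm := hf.measurable
  have hmeas : MeasurableSet {x | BddAbove (range fun n => birkhoffSum f g n x)} := by
    refine measurableSet_bddAbove_range fun n => ?_
    unfold birkhoffSum
    exact Finset.measurable_sum _ fun k _ => hgm.comp (hfm.iterate k)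
  have hinv : f ⁻¹' {x | BddAbove (range fun n => birkhoffSum f g n x)} =
      {x | BddAbove (range fun n => birkhoffSum f g n x)} :=
    Set.ext fun x => bddAbove_birkhoffSum_apply_iff x
  have hmp : MeasurePreserving f μ μ := hf.toMeasurePreserving
  rcases eventuallyConst_set.1 (hf.aeconst_set hmeas hinv) with h | h
  · exact h
  exfalso
  refine hneg.not_ge ?_
  have hMi := fun n => integrable_maxBirkhoffSum (g := g) hmp hg n
  have hlim : Tendsto (fun n => ∫ x, (maxBirkhoffSum f g (n + 1) x -
      maxBirkhoffSum f g n (f x)) ∂μ) atTop (𝓝 (∫ x, g x ∂μ)) := by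
    refine tendsto_integral_of_dominated_convergence (fun x => |g x|) (fun n => ?_) hg.abs
      (fun n => ae_of_all _ fun x => ?_) ?_
    · exact ((hMi (n + 1)).sub (hmp.integrable_comp_of_integrable (hMi n))).aestronglyMeasurable
    · have h0 := maxBirkhoffSum_nonneg (f := f) (g := g) n (f x)
      rw [Real.norm_eq_abs, maxBirkhoffSum]
      rcases le_total 0 (g x + maxBirkhoffSum f g n (f x)) with h1 | h1
      · rw [max_eq_right h1, add_sub_cancel_right]
      · rw [max_eq_left h1, zero_sub, abs_neg, abs_of_nonneg h0]
        exact le_trans (by linarith) (neg_le_abs (g x))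
    · filter_upwards [h] with x hx
      have hx' : ¬ BddAbove (range fun n => birkhoffSum f g n (f x)) := fun h' =>
        hx ((bddAbove_birkhoffSum_apply_iff x).1 h')
      refine tendsto_const_nhds.congr' ?_
      filter_upwards [(tendsto_maxBirkhoffSum_atTop hx').eventually_ge_atTop (-g x)] with n hn
      rw [maxBirkhoffSum, max_eq_right (by linarith), add_sub_cancel_right]
  refine ge_of_tendsto' hlim fun n => ?_
  have hcomp : ∫ x, maxBirkhoffSum f g n (f x) ∂μ = ∫ x, maxBirkhoffSum f g n x ∂μ := by
    conv_rhs => rw [← hmp.map_eq]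
    rw [integral_map hfm.aemeasurable
      (measurable_maxBirkhoffSum hfm hgm n).aestronglyMeasurable]
  have hfi : Integrable (fun x => maxBirkhoffSum f g n (f x)) μ :=
    hmp.integrable_comp_of_integrable (hMi n)
  rw [integral_sub (hMi (n + 1)) hfi, hcomp, sub_nonneg]
  exact integral_mono (hMi n) (hMi (n + 1)) fun x => monotone_maxBirkhoffSum x n.le_succ

end Birkhoff

open Classical in
/-- A sequence with increments at most `1` has at least as many record times as its height. -/
theorem le_card_record_times {T : ℕ → ℝ} (h0 : T 0 ≤ 0) (h1 : ∀ n, T (n + 1) ≤ T n + 1) (N : ℕ) :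
    T N ≤ (((Finset.Icc 1 N).filter fun n => ∀ m ≤ n, T m ≤ T n).card : ℝ) := by
  suffices H : ∀ m ≤ N, T m ≤ (((Finset.Icc 1 N).filter fun n => ∀ m ≤ n, T m ≤ T n).card : ℝ) from
    H N le_rfl
  induction N with
  | zero =>
    intro m hm
    obtain rfl : m = 0 := by omega
    simpa using h0
  | succ N ih =>
    intro m hm
    have hIcc : Finset.Icc 1 (N + 1) = insert (N + 1) (Finset.Icc 1 N) := by
      ext j; simp only [Finset.mem_Icc, Finset.mem_insert]; omega
    have hnot : N + 1 ∉ (Finset.Icc 1 N).filter fun n => ∀ m ≤ n, T m ≤ T n := by simp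
    rw [hIcc, Finset.filter_insert]
    split_ifs with hrec
    · rw [Finset.card_insert_of_notMem hnot]
      push_cast
      rcases Nat.le_succ_iff.1 hm with h | rfl
      · linarith [ih m h]
      · linarith [ih N le_rfl, h1 N]
    · rcases Nat.le_succ_iff.1 hm with h | rfl
      · exact ih m h
      · push Not at hrec
        obtain ⟨j, hj, hj'⟩ := hrec
        have hjN : j ≤ N := by
          rcases Nat.le_succ_iff.1 hj with h | rfl
          · exact h
          · exact absurd hj' (lt_irrefl _)
        exact hj'.le.trans (ih j hjN)

theorem integrable_leb_of_integrableOn {g : Circ → ℝ} (hgm : Measurable g)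
    (hg : IntegrableOn (fun t : ℝ => g (t : Circ)) (Ioo (-1) 1)) : Integrable g leb := by
  refine ⟨hgm.aestronglyMeasurable, ?_⟩
  have h := hg.2
  rw [hasFiniteIntegral_iff_enorm] at h ⊢
  rw [lintegral_leb hgm.enorm]
  exact ENNReal.mul_lt_top (by simp) h

instance isAddHaarMeasure_leb : leb.IsAddHaarMeasure :=
  inferInstanceAs (AddCircle.haarAddCircle (T := 2)).IsAddHaarMeasure

theorem integrable_log_norm : Integrable (fun x : Circ => Real.log ‖x‖) leb := by
  refine integrable_leb_of_integrableOn (Real.measurable_log.comp measurable_norm) ?_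
  have h : IntegrableOn Real.log (Ioo (-1 : ℝ) 1) :=
    ((intervalIntegrable_iff_integrableOn_Ioc_of_le (by norm_num)).1
      (intervalIntegral.intervalIntegrable_log' (a := -1) (b := 1))).mono_set Ioo_subset_Ioc_self
  refine h.congr_fun (fun t ht => ?_) measurableSet_Ioo
  simp only [norm_coe (Ioo_subset_Icc_self ht), Real.log_abs]

theorem continuous_infDist_excSet : Continuous fun x : Circ => Metric.infDist x excSet :=
  Metric.continuous_infDist_pt _

theorem integrable_log_infDist :
    Integrable (fun x : Circ => Real.log (Metric.infDist x excSet)) leb := by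
  have h2 : Integrable (fun x : Circ => Real.log (1 - ‖x‖)) leb := by
    simp only [← norm_sub_one]
    exact integrable_log_norm.comp_sub_right _
  refine (integrable_log_norm.abs.add h2.abs).mono'
    (Real.measurable_log.comp continuous_infDist_excSet.measurable).aestronglyMeasurable
    (ae_of_all _ fun x => ?_)
  rw [infDist_excSet, Real.norm_eq_abs, Pi.add_apply]
  rcases min_choice ‖x‖ (1 - ‖x‖) with h | h <;> rw [h]
  · linarith [abs_nonneg (Real.log (1 - ‖x‖))]
  · linarith [abs_nonneg (Real.log ‖x‖)]

theorem infDist_excSet_le_one (x : Circ) : Metric.infDist x excSet ≤ 1 := by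
  rw [infDist_excSet]; exact (min_le_left _ _).trans (norm_le_one x)

theorem truncDist_le_one (δ : ℝ) (x : Circ) : truncDist excSet δ x ≤ 1 := by
  unfold truncDist
  split_ifs
  · exact infDist_excSet_le_one x
  · exact le_rfl

theorem truncDist_pos {δ : ℝ} {x : Circ} (hx : x ∉ excSet) : 0 < truncDist excSet δ x := by
  unfold truncDist
  split_ifs
  · exact infDist_excSet_pos hx
  · exact one_pos

theorem truncDist_nonneg (δ : ℝ) (x : Circ) : 0 ≤ truncDist excSet δ x := by
  unfold truncDist
  split_ifs
  · exact Metric.infDist_nonneg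
  · exact zero_le_one

theorem measurable_truncDist (δ : ℝ) : Measurable (truncDist excSet δ) :=
  Measurable.ite (measurableSet_le continuous_infDist_excSet.measurable measurable_const)
    continuous_infDist_excSet.measurable measurable_const

theorem abs_log_truncDist_le (δ : ℝ) (x : Circ) :
    |Real.log (truncDist excSet δ x)| ≤ |Real.log (Metric.infDist x excSet)| := by
  unfold truncDist
  split_ifs
  · exact le_rfl
  · simp

theorem integrable_log_truncDist (δ : ℝ) :
    Integrable (fun x => Real.log (truncDist excSet δ x)) leb :=
  integrable_log_infDist.abs.mono'
    (Real.measurable_log.comp (measurable_truncDist δ)).aestronglyMeasurable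
    (ae_of_all _ fun x => abs_log_truncDist_le δ x)

theorem exists_integral_neg_log_truncDist_lt {ε : ℝ} (hε : 0 < ε) :
    ∃ δ : ℝ, 0 < δ ∧ ∫ x, -Real.log (truncDist excSet δ x) ∂leb < ε := by
  have hlim : Tendsto (fun n : ℕ => ∫ x, -Real.log (truncDist excSet (1 / ((n : ℝ) + 1)) x) ∂leb)
      atTop (𝓝 (∫ _, 0 ∂leb)) := by
    refine tendsto_integral_of_dominated_convergence
      (fun x => |Real.log (Metric.infDist x excSet)|)
      (fun n => (integrable_log_truncDist _).neg.aestronglyMeasurable) integrable_log_infDist.abs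
      (fun n => ae_of_all _ fun x => ?_) (ae_of_all _ fun x => ?_)
    · rw [norm_neg]; exact abs_log_truncDist_le _ x
    · refine tendsto_const_nhds.congr' ?_
      rcases (Metric.infDist_nonneg (x := x) (s := excSet)).eq_or_lt with h | h
      · refine Eventually.of_forall fun n => ?_
        have : truncDist excSet (1 / ((n : ℝ) + 1)) x = 0 := by
          unfold truncDist
          rw [← h, if_pos (by positivity)]
        change (0 : ℝ) = -Real.log (truncDist excSet (1 / ((n : ℝ) + 1)) x)
        rw [this]; simp
      · filter_upwards [tendsto_one_div_add_atTop_nhds_zero_nat.eventually_lt_const h] with n hn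
        unfold truncDist
        rw [if_neg (not_le.2 hn)]; simp
  rw [integral_zero] at hlim
  obtain ⟨n, hn⟩ := (hlim.eventually_lt_const hε).exists
  exact ⟨1 / ((n : ℝ) + 1), by positivity, hn⟩

theorem integrable_one_sub_sqrt_norm : Integrable (fun x : Circ => 1 - √‖x‖) leb :=
  (by fun_prop : Continuous fun x : Circ => 1 - √‖x‖).integrable_of_hasCompactSupport
    (HasCompactSupport.of_compactSpace _)

theorem integral_one_sub_sqrt_norm_pos : 0 < ∫ x : Circ, (1 - √‖x‖) ∂leb := by
  have hc : Continuous fun x : Circ => 1 - √‖x‖ := by fun_prop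
  refine hc.integral_pos_of_hasCompactSupport_nonneg_nonzero
    (HasCompactSupport.of_compactSpace _) (fun x => ?_) (x := 0) (by simp)
  exact sub_nonneg.2 (Real.sqrt_le_one.2 (norm_le_one x))

theorem leb_excSet : leb excSet = 0 := by
  have hm : MeasurableSet excSet := (by simp [excSet] : excSet.Finite).measurableSet
  have hsub : ((↑) : ℝ → Circ) ⁻¹' excSet ∩ Ioo (-1) 1 ⊆ {0} := by
    rintro t ⟨ht, ht'⟩
    rw [mem_preimage, mem_excSet_iff, norm_coe (Ioo_subset_Icc_self ht')] at ht
    rcases ht with h | h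
    · exact abs_eq_zero.1 h
    · exact absurd (abs_lt.2 ht') (by rw [h]; exact lt_irrefl _)
  rw [leb_apply hm, measure_mono_null hsub (measure_singleton (0 : ℝ)), mul_zero]

theorem ae_iterate_notMem_excSet : ∀ᵐ x ∂leb, ∀ j : ℕ, circMap^[j] x ∉ excSet := by
  refine ae_all_iff.2 fun j => ?_
  have h : leb (circMap^[j] ⁻¹' excSet) = 0 :=
    (measurePreserving_circMap.iterate j).quasiMeasurePreserving.preimage_null leb_excSet
  filter_upwards [measure_eq_zero_iff_ae_notMem.1 h] with x hx
  exact hx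

theorem sqrt_norm_le_exp (x : Circ) : √‖x‖ ≤ Real.exp (-(1 - √‖x‖)) := by
  have := Real.add_one_le_exp (-(1 - √‖x‖))
  linarith

/-- Record times of the sums of `1 - √‖x‖ - lam + log (dist_δ x) / (lam * b)` along an orbit are
hyperbolic times. -/
theorem isHyperbolicTime_of_record {lam b δ : ℝ} (hlam : 0 < lam) (hb : 0 < b) {x : Circ}
    (hx : ∀ j : ℕ, circMap^[j] x ∉ excSet) {n : ℕ} (hn : 1 ≤ n)
    (hrec : ∀ m ≤ n,
      birkhoffSum circMap
          (fun z => 1 - √‖z‖ - lam + Real.log (truncDist excSet δ z) / (lam * b)) m x ≤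
        birkhoffSum circMap
          (fun z => 1 - √‖z‖ - lam + Real.log (truncDist excSet δ z) / (lam * b)) n x) :
    IsHyperbolicTime circMap excSet b (Real.exp (-lam)) δ n x := by
  refine ⟨hn, fun k hk hkn => ?_⟩
  have h := hrec (n - k) (Nat.sub_le n k)
  simp only [birkhoffSum] at h
  rw [← sub_nonneg, ← Finset.sum_Ico_eq_sub _ (Nat.sub_le n k), Finset.sum_add_distrib] at h
  have hcard : (Finset.Ico (n - k) n).card = k := by rw [Nat.card_Ico]; omega
  have hsum : ∑ j ∈ Finset.Ico (n - k) n, (1 - √‖circMap^[j] x‖ - lam) =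
      ∑ j ∈ Finset.Ico (n - k) n, (1 - √‖circMap^[j] x‖) - k * lam := by
    rw [Finset.sum_sub_distrib, Finset.sum_const, hcard, nsmul_eq_mul]
  have hlog : ∀ j, Real.log (truncDist excSet δ (circMap^[j] x)) / (lam * b) ≤ 0 := fun j =>
    div_nonpos_of_nonpos_of_nonneg
      (Real.log_nonpos (truncDist_nonneg _ _) (truncDist_le_one _ _)) (by positivity)
  have hmem : n - k ∈ Finset.Ico (n - k) n := Finset.mem_Ico.2 ⟨le_rfl, by omega⟩
  have hle : ∑ j ∈ Finset.Ico (n - k) n,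
      Real.log (truncDist excSet δ (circMap^[j] x)) / (lam * b) ≤
      Real.log (truncDist excSet δ (circMap^[n - k] x)) / (lam * b) := by
    rw [← Finset.add_sum_erase _ _ hmem]
    linarith [Finset.sum_nonpos fun j (_ : j ∈ (Finset.Ico (n - k) n).erase (n - k)) => hlog j]
  have hw : (k : ℝ) * lam - Real.log (truncDist excSet δ (circMap^[n - k] x)) / (lam * b) ≤
      ∑ j ∈ Finset.Ico (n - k) n, (1 - √‖circMap^[j] x‖) := by linarith
  constructor
  · simp only [inv_abs_circDeriv_circMap]
    calc ∏ j ∈ Finset.Ico (n - k) n, √‖circMap^[j] x‖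
        ≤ ∏ j ∈ Finset.Ico (n - k) n, Real.exp (-(1 - √‖circMap^[j] x‖)) :=
          Finset.prod_le_prod (fun _ _ => Real.sqrt_nonneg _) fun _ _ => sqrt_norm_le_exp _
      _ = Real.exp (-∑ j ∈ Finset.Ico (n - k) n, (1 - √‖circMap^[j] x‖)) := by
          rw [← Real.exp_sum, Finset.sum_neg_distrib]
      _ ≤ Real.exp (k * -lam) := Real.exp_le_exp.2 (by linarith [hlog (n - k)])
      _ = Real.exp (-lam) ^ k := Real.exp_nat_mul _ _
  · have hk1 : ∑ j ∈ Finset.Ico (n - k) n, (1 - √‖circMap^[j] x‖) ≤ k := by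
      refine (Finset.sum_le_card_nsmul _ _ 1 fun j _ => ?_).trans (by simp [hcard])
      linarith [Real.sqrt_nonneg ‖circMap^[j] x‖]
    rw [← Real.exp_mul, ← Real.le_log_iff_exp_le (truncDist_pos (hx _))]
    have h3 : -(k : ℝ) ≤ Real.log (truncDist excSet δ (circMap^[n - k] x)) / (lam * b) := by
      have : (0 : ℝ) ≤ k * lam := by positivity
      linarith
    rw [le_div_iff₀ (by positivity)] at h3
    linarith

theorem exists_ae_hasHyperbolicFrequency {b : ℝ} (hb : 0 < b) :
    ∃ σ δ θ : ℝ, 0 < σ ∧ σ < 1 ∧ 0 < δ ∧ 0 < θ ∧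
      ∀ᵐ x ∂leb, HasHyperbolicFrequency circMap excSet b σ δ θ x := by
  classical
  have hI := integral_one_sub_sqrt_norm_pos
  set lam : ℝ := (∫ x : Circ, (1 - √‖x‖) ∂leb) / 3 with hlamdef
  have hlam : 0 < lam := by positivity
  obtain ⟨δ, hδ, hδ'⟩ := exists_integral_neg_log_truncDist_lt (ε := lam ^ 2 * b) (by positivity)
  refine ⟨Real.exp (-lam), δ, lam / 2, Real.exp_pos _, by rw [Real.exp_lt_one_iff]; linarith, hδ,
    by positivity, ?_⟩
  set v : Circ → ℝ := fun z => 1 - √‖z‖ - lam + Real.log (truncDist excSet δ z) / (lam * b)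
    with hv
  have hvm : Measurable v :=
    ((measurable_const.sub measurable_norm.sqrt).sub_const lam).add
      ((Real.measurable_log.comp (measurable_truncDist δ)).div_const _)
  have hvi : Integrable v leb :=
    (integrable_one_sub_sqrt_norm.sub (integrable_const lam)).add
      ((integrable_log_truncDist δ).div_const _)
  have hvint : lam < ∫ x, v x ∂leb := by
    have e : ∫ x, v x ∂leb = (∫ x : Circ, (1 - √‖x‖) ∂leb) - lam +
        (∫ x, Real.log (truncDist excSet δ x) ∂leb) / (lam * b) := by
      have hi : Integrable (fun x : Circ => 1 - √‖x‖ - lam) leb :=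
        integrable_one_sub_sqrt_norm.sub (integrable_const lam)
      rw [hv, integral_add hi ((integrable_log_truncDist δ).div_const _),
        integral_sub integrable_one_sub_sqrt_norm (integrable_const lam),
        integral_div (lam * b) fun x => Real.log (truncDist excSet δ x), integral_const]
      simp
    rw [integral_neg] at hδ'
    have h1 : -lam < (∫ x, Real.log (truncDist excSet δ x) ∂leb) / (lam * b) := by
      rw [lt_div_iff₀ (by positivity)]
      nlinarith
    rw [e]
    linarith
  have hneg : ∫ x, (lam - v x) ∂leb < 0 := by
    rw [integral_sub (integrable_const lam) hvi]
    simpa using hvint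
  have hbdd := ergodic_circMap.ae_bddAbove_birkhoffSum (g := fun x => lam - v x)
    (measurable_const.sub hvm) ((integrable_const lam).sub hvi) hneg
  filter_upwards [hbdd, ae_iterate_notMem_excSet] with x hx hxS
  obtain ⟨C, hC⟩ := hx
  have hv1 : ∀ z, v z ≤ 1 := fun z => by
    have : Real.log (truncDist excSet δ z) / (lam * b) ≤ 0 :=
      div_nonpos_of_nonpos_of_nonneg
        (Real.log_nonpos (truncDist_nonneg _ _) (truncDist_le_one _ _)) (by positivity)
    simp only [hv]
    linarith [Real.sqrt_nonneg ‖z‖]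
  have hgrow : ∀ n : ℕ, lam * n - C ≤ birkhoffSum circMap v n x := fun n => by
    have h1 := hC ⟨n, rfl⟩
    simp only [birkhoffSum, Finset.sum_sub_distrib, Finset.sum_const, Finset.card_range,
      nsmul_eq_mul] at h1 ⊢
    linarith
  filter_upwards [eventually_ge_atTop ⌈2 * C / lam⌉₊] with n hn
  refine ⟨(Finset.Icc 1 n).filter fun n => ∀ m ≤ n, birkhoffSum circMap v m x ≤
    birkhoffSum circMap v n x, fun j hj => ?_, ?_⟩
  · rw [Finset.mem_filter, Finset.mem_Icc] at hj
    exact ⟨hj.1.2, isHyperbolicTime_of_record hlam hb hxS hj.1.1 hj.2⟩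
  · have hcard := le_card_record_times (T := fun n => birkhoffSum circMap v n x) (by simp)
      (fun n => by simp only [birkhoffSum_succ]; linarith [hv1 (circMap^[n] x)]) n
    refine le_trans ?_ (le_trans (hgrow n) (hcard.trans (le_of_eq ?_)))
    · have h2 := Nat.ceil_le.1 hn
      rw [div_le_iff₀ hlam] at h2
      linarith
    · congr!

end HypTimes

theorem mainTheorem4 :
    -- the map is a local homeomorphism, differentiable exactly off `0`, and a `C²` local
    -- diffeomorphism outside the non-degenerate exceptional set
    (Continuous HypTimes.circMap ∧ IsLocalHomeomorph HypTimes.circMap) ∧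
    (∀ x : HypTimes.Circ, DifferentiableAt ℝ (HypTimes.localRep HypTimes.circMap x) 0 ↔ x ≠ 0) ∧
    HypTimes.IsC2LocalDiffeoOutside HypTimes.circMap HypTimes.excSet ∧
    (∃ B β : ℝ,
      HypTimes.IsNondegenerateExceptional HypTimes.circMap HypTimes.excSet B β) ∧
    -- topological mixing, also in the form: every nonempty open set is eventually mapped onto
    -- the whole circle
    HypTimes.IsTopologicallyMixing HypTimes.circMap ∧
    (∀ J : Set HypTimes.Circ, IsOpen J → J.Nonempty →
      ∃ N : ℕ, HypTimes.circMap^[N] '' J = Set.univ) ∧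
    -- invariance of Lebesgue measure
    MeasurePreserving HypTimes.circMap HypTimes.leb HypTimes.leb ∧
    (∀ B β : ℝ, HypTimes.IsNondegenerateExceptional HypTimes.circMap HypTimes.excSet B β →
      ∀ b : ℝ, 0 < b → b < min (1 / 2) (1 / (4 * β)) →
        -- positive frequency of hyperbolic times
        (∃ σ δ θ : ℝ, 0 < σ ∧ σ < 1 ∧ 0 < δ ∧ 0 < θ ∧ ∀ᵐ x ∂HypTimes.leb,
          HypTimes.HasHyperbolicFrequency HypTimes.circMap HypTimes.excSet b σ δ θ x) ∧
        -- non-integrability of every first hyperbolic time map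
        (∀ σ δ : ℝ, 0 < σ → σ < 1 → 0 < δ →
          ∫⁻ x, HypTimes.firstHyperbolicTime HypTimes.circMap HypTimes.excSet b σ δ x
            ∂HypTimes.leb = ∞)) ∧
    -- divergence of the series along the orbit of the inverse branch
    (∀ x : ℕ → ℝ, x 1 ∈ Set.Ioo (0 : ℝ) 1 →
      (∀ n : ℕ, 1 ≤ n → x (n + 1) = (1 + x n) ^ 2 / 4) →
      Tendsto (fun N : ℕ => ∑ n ∈ Finset.Icc 1 N, (n : ℝ) * (x (n + 1) - x n)) atTop atTop) := by
  open HypTimes in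
  exact ⟨⟨continuous_circMap, isLocalHomeomorph_circMap⟩, differentiableAt_localRep_circMap_iff,
    isC2LocalDiffeoOutside_circMap, ⟨2, 1, isNondegenerateExceptional_circMap⟩,
    isTopologicallyMixing_circMap, circMap_eventually_onto, measurePreserving_circMap,
    fun _ _ _ _ hb _ => ⟨exists_ae_hasHyperbolicFrequency hb,
      fun _ _ hσ0 hσ1 _ => lintegral_firstHyperbolicTime_circMap hσ0 hσ1⟩,
    fun _ h1 hx => tendsto_sum_mul_orbit_sub_atTop h1 hx⟩
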